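/- Let $M\subset\mathbb R^3$ be a smooth compact connected surface, the boundary of a bounded open set, with outward unit normal $\nu$; assume that $M$ has positive Gauss curvature and is invariant under the rotations about the $x_3$-axis (so that $M$ is diffeomorphic to $S^2$). Let $X_3=(-x_2,x_1,0)$ be the generator of these rotations, let $Jv=\nu\times v$ be the counterclockwise rotation by $90^\circ$ in the tangent planes of $M$, let $\nabla$, $\Delta$ and $dS$ be the gradient, the Laplace--Beltrami operator and the area measure of $M$, and let $\chi=e_3\cdot\nu$. Let $\xi\in C^\infty(M)$ satisfy $J\nabla\xi=-X_3$, and put $\alpha_0=\min_M\xi$, $\alpha_1=\max_M\xi$. Let $f\in C^\infty(M)$ be a real zonal function, i.e. $X_3f=0$, let $w=\Delta f$, and let $\Omega\in\mathbb R$. Then $f$, $w$ and $\chi$ are functions of $\xi$, smooth in $\xi\in(\alpha_0,\alpha_1)$; write $f=f(\xi)$, $w=w(\xi)$, $\chi=\chi(\xi)$. On the complex space $L^2_b(M)=\{\zeta\in L^2(M):\int_M\zeta\,dS=0\}$ consider the linearization at the steady zonal flow $u=J\nabla f$ of the vorticity form of the Euler equation with Coriolis term, $$\Gamma\zeta=-\nabla_{J\nabla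 f}\,\zeta+\nabla_{J\nabla(w-\Omega\chi)}\,\Delta^{-1}\zeta ,$$ where $\Delta^{-1}\zeta$ is the solution $\eta$ of $\Delta\eta=\zeta$ with $\int_M\eta\,dS=0$, the derivatives are taken in the sense of distributions, and the domain of $\Gamma$ consists of all $\zeta\in L^2_b(M)$ with $\Gamma\zeta\in L^2_b(M)$. If $\Gamma$ has an eigenvalue with nonzero real part, then (i) $w'(s)-\Omega\chi'(s)$ changes sign on $(\alpha_0,\alpha_1)$, i.e. it takes both a positive and a negative value there; and (ii) for every $K\in\mathbb R$ there is an $s\in(\alpha_0,\alpha_1)$ such that $(w'(s)-\Omega\chi'(s))(f'(s)-K)<0$. -/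

import Mathlib

open MeasureTheory Filter Set
open scoped ContDiff Topology

noncomputable section

namespace RotatingSurface

/-- Euclidean three-space. The rotation axis is the axis of the coordinate with index `2`
(the third coordinate). -/
abbrev E3 : Type := EuclideanSpace ℝ (Fin 3)

/-- The cross product on Euclidean three-space. -/
def cross (a b : E3) : E3 := WithLp.toLp 2 (crossProduct a.ofLp b.ofLp)

/-- The rotation by the angle `s` about the third coordinate axis. -/
def axisRotation (s : ℝ) (x : E3) : E3 :=
  !₂[Real.cos s * x 0 - Real.sin s * x 1, Real.sin s * x 0 + Real.cos s * x 1, x 2]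

/-- The vector field `X₃` that generates the rotations about the third coordinate axis. -/
def rotationField (x : E3) : E3 := !₂[-x 1, x 0, 0]

/-- A compact connected smooth surface in three-space: the boundary of a bounded open set `body`,
together with its outward unit normal field `normal` (which matters, and is determined, only at the
points of the surface). Near each boundary point `body` is a sublevel set `{g < 0}` of a smooth
function with nonzero gradient, and the outward unit normal is the normalized gradient of `g`. -/
structure ClosedSurface where
  body : Set E3
  normal : E3 → E3
  isOpen_body : IsOpen body
  isBounded_body : Bornology.IsBounded body
  isConnected_frontier : IsConnected (frontier body)
  exists_defining_function : ∀ x ∈ frontier body, ∃ g : E3 → ℝ,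
    ContDiff ℝ ∞ g ∧ gradient g x ≠ 0 ∧ (∀ᶠ y in 𝓝 x, y ∈ body ↔ g y < 0) ∧
      normal x = ‖gradient g x‖⁻¹ • gradient g x

namespace ClosedSurface

variable (M : ClosedSurface)

/-- The surface as a set of points. -/
def carrier : Set E3 := frontier M.body

/-- The surface area measure `dS`. -/
def area : Measure E3 := (Measure.euclideanHausdorffMeasure 2).restrict M.carrier

/-- The tangent plane `T_x M`. -/
def tangentPlane (x : E3) : Submodule ℝ E3 := (Submodule.span ℝ {M.normal x})ᗮ

/-- `J`, the counterclockwise rotation by a right angle in the tangent planes. -/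
def J (x v : E3) : E3 := cross (M.normal x) v

/-- `h ∈ C^∞(M)`: the function `h` is, on the surface, the restriction of a smooth function. -/
def Smooth (h : E3 → ℝ) : Prop := ∃ H : E3 → ℝ, ContDiff ℝ ∞ H ∧ EqOn h H M.carrier

/-- The gradient of a function on the surface: the tangential part of its gradient within the
surface. It depends only on the values of `h` on the surface. -/
def surfaceGradient (h : E3 → ℝ) (x : E3) : E3 :=
  (M.tangentPlane x).starProjection (gradientWithin h M.carrier x)

/-- The endomorphism `v ↦ proj (D_v V)` of the tangent plane at `x`, for a vector field `V`
along the surface. -/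
def tangentialDerivative (V : E3 → E3) (x : E3) : M.tangentPlane x →ₗ[ℝ] M.tangentPlane x :=
  ((M.tangentPlane x).orthogonalProjectionOnto ∘L fderivWithin ℝ V M.carrier x ∘L
    (M.tangentPlane x).subtypeL).toLinearMap

/-- The divergence of a tangent vector field on the surface. -/
def surfaceDivergence (V : E3 → E3) (x : E3) : ℝ :=
  LinearMap.trace ℝ (M.tangentPlane x) (M.tangentialDerivative V x)

/-- The Laplace--Beltrami operator on functions on the surface. -/
def laplacian (h : E3 → ℝ) (x : E3) : ℝ := M.surfaceDivergence (M.surfaceGradient h) x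

/-- The Gauss curvature: the determinant of the differential of the Gauss map. -/
def gaussCurvature (x : E3) : ℝ := LinearMap.det (M.tangentialDerivative M.normal x)

/-- Invariance under all rotations about the third coordinate axis. -/
def IsRotationInvariant : Prop := ∀ s : ℝ, ∀ x ∈ M.carrier, axisRotation s x ∈ M.carrier

/-- Positive Gauss curvature everywhere. -/
def HasPositiveCurvature : Prop := ∀ x ∈ M.carrier, 0 < M.gaussCurvature x

/-- The Coriolis function `χ = e₃ · ν`. -/
def chi (x : E3) : ℝ := M.normal x 2

/-- Zonal functions: `f ∈ C^∞(M)` with `X₃ f = 0`. -/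
def IsZonal (f : E3 → ℝ) : Prop :=
  M.Smooth f ∧ ∀ x ∈ M.carrier, inner ℝ (rotationField x) (M.surfaceGradient f x) = 0

/-- A function `ξ ∈ C^∞(M)` with `J ∇ξ = -X₃`. -/
def IsRotationPotential (ξ : E3 → ℝ) : Prop :=
  M.Smooth ξ ∧ ∀ x ∈ M.carrier, M.J x (M.surfaceGradient ξ x) = -rotationField x

/-- `h ∈ H¹(M)` with weak gradient `G`: the pair `(h, G)` is a limit in `L²` of pairs `(φ, ∇φ)` with
`φ ∈ C^∞(M)`. -/
def HasSobolevGradient (h : E3 → ℝ) (G : E3 → E3) : Prop :=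
  MemLp h 2 M.area ∧ MemLp G 2 M.area ∧
    ∃ φ : ℕ → E3 → ℝ, (∀ n, M.Smooth (φ n)) ∧
      Tendsto (fun n => eLpNorm (fun x => φ n x - h x) 2 M.area) atTop (𝓝 0) ∧
      Tendsto (fun n => eLpNorm (fun x => M.surfaceGradient (φ n) x - G x) 2 M.area) atTop (𝓝 0)

/-- `η = Δ⁻¹ ζ` for a real function `ζ ∈ L²(M)` with integral zero: `η` is the function in `H¹(M)`
with integral zero that satisfies `Δη = ζ` weakly. -/
def IsInverseLaplacian (ζ η : E3 → ℝ) : Prop :=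
  ∫ x, η x ∂M.area = 0 ∧
    ∃ G : E3 → E3, M.HasSobolevGradient η G ∧
      ∀ φ : E3 → ℝ, M.Smooth φ →
        ∫ x, inner ℝ (G x) (M.surfaceGradient φ x) ∂M.area = -∫ x, ζ x * φ x ∂M.area

/-- Membership in the complex space `L²_b(M)` of square integrable functions with integral zero. -/
def MemL2b (ζ : E3 → ℂ) : Prop := MemLp ζ 2 M.area ∧ ∫ x, ζ x ∂M.area = 0

/-- The graph of the linearized operator
`Γζ = -∇_{J∇f} ζ + ∇_{J∇(w - Ωχ)} Δ⁻¹ζ`, `w = Δf`, on the complex space `L²_b(M)`: this says that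
`ζ` and `θ` belong to `L²_b(M)` and that `Γζ = θ`. The real operator `Δ⁻¹` acts on real and imaginary
parts, and the derivatives along the divergence free vector fields `J∇f` and `J∇(w - Ωχ)` are taken
in the sense of distributions. -/
def LinearizedGraph (f : E3 → ℝ) (Ω : ℝ) (ζ θ : E3 → ℂ) : Prop :=
  M.MemL2b ζ ∧ M.MemL2b θ ∧
    ∃ η : E3 → ℂ,
      M.IsInverseLaplacian (fun x => (ζ x).re) (fun x => (η x).re) ∧
      M.IsInverseLaplacian (fun x => (ζ x).im) (fun x => (η x).im) ∧
      ∀ φ : E3 → ℝ, M.Smooth φ →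
        ∫ x, θ x * (φ x : ℂ) ∂M.area =
          (∫ x, ζ x * ((inner ℝ (M.J x (M.surfaceGradient f x))
              (M.surfaceGradient φ x) : ℝ) : ℂ) ∂M.area) -
            ∫ x, η x * ((inner ℝ
              (M.J x (M.surfaceGradient (fun y => M.laplacian f y - Ω * M.chi y) x))
              (M.surfaceGradient φ x) : ℝ) : ℂ) ∂M.area

/-- `lam` is an eigenvalue of `Γ`. -/
def IsLinearizedEigenvalue (f : E3 → ℝ) (Ω : ℝ) (lam : ℂ) : Prop :=
  ∃ ζ : E3 → ℂ, ¬ (ζ =ᵐ[M.area] 0) ∧ M.LinearizedGraph f Ω ζ (fun x => lam * ζ x)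

end ClosedSurface

end RotatingSurface

end

/-!
The argument is that of Rayleigh and Fjørtoft for parallel shear flows, with the orbits of the
rotations as streamlines and `ξ` as the transversal coordinate.

Since `J∇ξ = -X₃`, the gradient of `ξ` has length equal to the distance `r` to the axis, so `ξ` is
strictly monotone along the profile curve of the surface and separates the orbits
(`IsRotationPotential.injOn_profile`, proved with the general criterion
`injective_of_local_sections`). A rotation-invariant smooth function is therefore a function of `ξ`,
smooth on `(α₀, α₁)` because off the axis `ξ` is a smooth parameter of the profile curve
(`IsRotationPotential.exists_factorization`). This applies to `f`, `Δf` and `χ`, and it turns the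
derivatives along `J∇f` and `J∇(w - Ωχ)` into `-F'(ξ) X₃` and `-G(ξ) X₃` with `G = W' - Ω X'`.

Let `Γζ = λζ` with `Re λ ≠ 0` and `Δη = ζ`. Some angular Fourier mode `ζ_k` of `ζ` is not zero
(`RotationPreserving.exists_mode_ne_zero`). Two facts about `ζ_k` and the mode `η_k` carry the proof:

* the eigenvalue equation becomes, pointwise almost everywhere,
  `λ ζ_k = ik (F'(ξ) ζ_k - G(ξ) η_k)` (`ae_mode_equation`);
* the energy identity `∫ ζ_k η̄_k = -E` with `E = ‖∇η_k‖² > 0` (`exists_energy`). In order to take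
  modes of vector fields, gradients are expanded in an orthonormal frame that is invariant under the
  rotations; it exists off the axis, hence almost everywhere.

With `D = |λ - ikF'(ξ)|²`, the product of the first equation with `η̄_k` yields
`D Im (ζ_k η̄_k) = -k Re(λ) G |η_k|²`, so if `G` had a constant sign, the imaginary part, whose
integral is zero, would vanish, and then also the real part, against `E > 0`. It also yields
`D (Re (ζ_k η̄_k) + c Im (ζ_k η̄_k)) = k² G (F' - K) |η_k|²` for a constant `c` that depends on `K`;
if `G (F' - K) ≥ 0`, then integration gives `-E ≥ 0` (`sign_conditions`).
-/

noncomputable section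

namespace RotatingSurface

/-! ### Euclidean three-space, the cross product and rotations -/

lemma inner_E3 (x y : E3) : inner ℝ x y = x 0 * y 0 + x 1 * y 1 + x 2 * y 2 := by
  simp [PiLp.inner_apply, Fin.sum_univ_three, mul_comm]

lemma ext_E3 {x y : E3} (h0 : x 0 = y 0) (h1 : x 1 = y 1) (h2 : x 2 = y 2) : x = y := by
  ext i; fin_cases i <;> assumption

@[simp] lemma cross_zero (a b : E3) : cross a b 0 = a 1 * b 2 - a 2 * b 1 := by
  simp [cross, cross_apply]

@[simp] lemma cross_one (a b : E3) : cross a b 1 = a 2 * b 0 - a 0 * b 2 := by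
  simp [cross, cross_apply]

@[simp] lemma cross_two (a b : E3) : cross a b 2 = a 0 * b 1 - a 1 * b 0 := by
  simp [cross, cross_apply]

@[simp] lemma axisRotation_zero (s : ℝ) (x : E3) :
    axisRotation s x 0 = Real.cos s * x 0 - Real.sin s * x 1 := by simp [axisRotation]

@[simp] lemma axisRotation_one (s : ℝ) (x : E3) :
    axisRotation s x 1 = Real.sin s * x 0 + Real.cos s * x 1 := by simp [axisRotation]

@[simp] lemma axisRotation_two (s : ℝ) (x : E3) : axisRotation s x 2 = x 2 := by
  simp [axisRotation]

@[simp] lemma rotationField_zero (x : E3) : rotationField x 0 = -x 1 := by simp [rotationField]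

@[simp] lemma rotationField_one (x : E3) : rotationField x 1 = x 0 := by simp [rotationField]

@[simp] lemma rotationField_two (x : E3) : rotationField x 2 = 0 := by simp [rotationField]

lemma axisRotation_add (s t : ℝ) (x : E3) :
    axisRotation (s + t) x = axisRotation s (axisRotation t x) := by
  apply ext_E3 <;> simp [Real.cos_add, Real.sin_add] <;> ring

@[simp] lemma axisRotation_by_zero (x : E3) : axisRotation 0 x = x := by
  apply ext_E3 <;> simp

@[simp] lemma axisRotation_neg_axisRotation (s : ℝ) (x : E3) :
    axisRotation (-s) (axisRotation s x) = x := by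
  rw [← axisRotation_add]; simp

@[simp] lemma axisRotation_axisRotation_neg (s : ℝ) (x : E3) :
    axisRotation s (axisRotation (-s) x) = x := by
  rw [← axisRotation_add]; simp

lemma axisRotation_add_two_pi (s : ℝ) (x : E3) :
    axisRotation (s + 2 * Real.pi) x = axisRotation s x := by
  apply ext_E3 <;> simp

lemma inner_axisRotation (s : ℝ) (x y : E3) :
    inner ℝ (axisRotation s x) (axisRotation s y) = inner ℝ x y := by
  simp only [inner_E3, axisRotation_zero, axisRotation_one, axisRotation_two]
  linear_combination (x 0 * y 0 + x 1 * y 1) * Real.sin_sq_add_cos_sq s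

lemma norm_axisRotation (s : ℝ) (x : E3) : ‖axisRotation s x‖ = ‖x‖ := by
  have h := inner_axisRotation s x x
  rw [real_inner_self_eq_norm_sq, real_inner_self_eq_norm_sq] at h
  exact (pow_left_inj₀ (norm_nonneg _) (norm_nonneg _) two_ne_zero).1 h

/-- The rotation about the third axis as a linear isometry. -/
def rotationEquiv (s : ℝ) : E3 ≃ₗᵢ[ℝ] E3 where
  toFun := axisRotation s
  invFun := axisRotation (-s)
  left_inv := axisRotation_neg_axisRotation s
  right_inv := axisRotation_axisRotation_neg s
  map_add' x y := by apply ext_E3 <;> simp <;> ring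
  map_smul' c x := by apply ext_E3 <;> simp <;> ring
  norm_map' := norm_axisRotation s

@[simp] lemma rotationEquiv_apply (s : ℝ) (x : E3) : rotationEquiv s x = axisRotation s x := rfl

@[simp] lemma rotationEquiv_symm_apply (s : ℝ) (x : E3) :
    (rotationEquiv s).symm x = axisRotation (-s) x := rfl

lemma continuous_rotation : Continuous fun p : ℝ × E3 => axisRotation p.1 p.2 := by
  unfold axisRotation
  refine (PiLp.continuous_toLp 2 _).comp (continuous_pi fun i => ?_)
  fin_cases i <;> simp <;> fun_prop

lemma contDiff_axisRotation (s : ℝ) : ContDiff ℝ ∞ (axisRotation s) :=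
  (rotationEquiv s).toContinuousLinearEquiv.contDiff

lemma hasFDerivAt_axisRotation (s : ℝ) (x : E3) :
    HasFDerivAt (axisRotation s) ((rotationEquiv s).toContinuousLinearEquiv : E3 →L[ℝ] E3) x :=
  (rotationEquiv s).toContinuousLinearEquiv.hasFDerivAt

lemma contDiff_rotationField : ContDiff ℝ ∞ rotationField := by
  rw [contDiff_euclidean]
  intro i
  fin_cases i <;> simp <;> fun_prop

lemma rotationField_axisRotation (s : ℝ) (x : E3) :
    rotationField (axisRotation s x) = axisRotation s (rotationField x) := by
  apply ext_E3 <;> simp <;> ring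

lemma hasDerivAt_E3 {c : ℝ → E3} {v : E3} {s : ℝ}
    (h : ∀ i, HasDerivAt (fun t => c t i) (v i) s) : HasDerivAt c v s := by
  have h1 : HasDerivAt (fun t i => c t i) (fun i => v i) s := hasDerivAt_pi.2 h
  exact ((EuclideanSpace.equiv (Fin 3) ℝ).symm.hasFDerivAt.comp_hasDerivAt s h1 :)

lemma hasDerivAt_axisRotation (s : ℝ) (x : E3) :
    HasDerivAt (fun t => axisRotation t x) (rotationField (axisRotation s x)) s := by
  refine hasDerivAt_E3 fun i => ?_
  fin_cases i
  · refine (((Real.hasDerivAt_cos s).mul_const (x 0)).sub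
      ((Real.hasDerivAt_sin s).mul_const (x 1))).congr_deriv ?_ |>.congr_of_eventuallyEq
      (Eventually.of_forall fun t => ?_) <;> simp
    ring
  · refine (((Real.hasDerivAt_sin s).mul_const (x 0)).add
      ((Real.hasDerivAt_cos s).mul_const (x 1))).congr_deriv ?_ |>.congr_of_eventuallyEq
      (Eventually.of_forall fun t => ?_) <;> simp
    ring
  · simpa using hasDerivAt_const s (x 2)

lemma cross_axisRotation (s : ℝ) (a b : E3) :
    cross (axisRotation s a) (axisRotation s b) = axisRotation s (cross a b) := by
  apply ext_E3 <;> simp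
  · ring
  · ring
  · linear_combination (a 0 * b 1 - a 1 * b 0) * Real.sin_sq_add_cos_sq s

lemma cross_smul (c : ℝ) (a b : E3) : cross a (c • b) = c • cross a b := by
  apply ext_E3 <;> simp <;> ring

lemma cross_neg (a b : E3) : cross a (-b) = -cross a b := by
  apply ext_E3 <;> simp <;> ring

lemma inner_cross_right (a b : E3) : inner ℝ b (cross a b) = 0 := by
  simp [inner_E3]; ring

lemma cross_cross {a b : E3} (ha : inner ℝ a a = (1 : ℝ)) (hab : inner ℝ a b = (0 : ℝ)) :
    cross a (cross a b) = -b := by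
  simp only [inner_E3] at ha hab
  apply ext_E3 <;> simp
  · linear_combination a 0 * hab - b 0 * ha
  · linear_combination a 1 * hab - b 1 * ha
  · linear_combination a 2 * hab - b 2 * ha

lemma inner_cross_cross {a b c : E3} (ha : inner ℝ a a = (1 : ℝ)) (hab : inner ℝ a b = (0 : ℝ)) :
    inner ℝ (cross a b) (cross a c) = (inner ℝ b c : ℝ) := by
  simp only [inner_E3] at ha hab
  simp only [inner_E3, cross_zero, cross_one, cross_two]
  linear_combination (b 0 * c 0 + b 1 * c 1 + b 2 * c 2) * ha -
    (a 0 * c 0 + a 1 * c 1 + a 2 * c 2) * hab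

/-! ### Charts from the inverse function theorem -/

/-- The inverse function theorem at a point where the derivative is injective. The map `B` inverts
the derivative of `Φ`. -/
lemma exists_chart {Φ : E3 → E3} (hΦ : ContDiff ℝ ∞ Φ) {x : E3} {A : E3 →L[ℝ] E3}
    (hA : HasFDerivAt Φ A x) (hinj : ∀ v, A v = 0 → v = 0) :
    ∃ e : OpenPartialHomeomorph E3 E3, (e : E3 → E3) = Φ ∧ x ∈ e.source ∧
      ContDiffAt ℝ ∞ e.symm (Φ x) ∧
      ∃ B : E3 →L[ℝ] E3, HasFDerivAt e.symm B (Φ x) ∧ ∀ v, B (A v) = v := by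
  have hker : Function.Injective (A : E3 →ₗ[ℝ] E3) := by
    rw [injective_iff_map_eq_zero]; exact hinj
  let A' : E3 ≃L[ℝ] E3 := (LinearEquiv.ofInjectiveEndo _ hker).toContinuousLinearEquiv
  have hAA' : (A' : E3 →L[ℝ] E3) = A := by ext v; rfl
  have hA' : HasFDerivAt Φ (A' : E3 →L[ℝ] E3) x := by rwa [hAA']
  have hne : (∞ : WithTop ℕ∞) ≠ 0 := by simp
  have hx := hΦ.contDiffAt.mem_toOpenPartialHomeomorph_source hA' hne
  refine ⟨hΦ.contDiffAt.toOpenPartialHomeomorph Φ hA' hne, rfl, hx,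
    hΦ.contDiffAt.to_localInverse hA' hne, (A'.symm : E3 →L[ℝ] E3), ?_, ?_⟩
  · exact (hΦ.contDiffAt.hasStrictFDerivAt' hA' hne).to_localInverse.hasFDerivAt
  · intro v
    rw [← hAA']
    exact A'.symm_apply_apply v

lemma fderiv_eq_inner_gradient (g : E3 → ℝ) (x v : E3) :
    fderiv ℝ g x v = inner ℝ (gradient g x) v := by
  simp [gradient]

lemma contDiff_gradient {g : E3 → ℝ} (hg : ContDiff ℝ ∞ g) : ContDiff ℝ ∞ (gradient g) :=
  (InnerProductSpace.toDual ℝ E3).symm.toContinuousLinearEquiv.contDiff.comp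
    (hg.fderiv_right (m := ∞) (by simp))

/-! ### The normal field of a closed surface -/

/-- A function decreases initially along a direction of negative slope. -/
lemma eventually_lt_zero_of_inner_gradient_neg {g : E3 → ℝ} (hg : ContDiff ℝ ∞ g) {y v : E3}
    (hy : g y = 0) (hv : inner ℝ (gradient g y) v < 0) :
    ∀ᶠ t : ℝ in 𝓝[>] 0, g (y + t • v) < 0 := by
  have hline : HasDerivAt (fun t : ℝ => y + t • v) v 0 := by
    simpa using ((hasDerivAt_id (0 : ℝ)).smul_const v).const_add y
  have hd : HasDerivAt (fun t : ℝ => g (y + t • v)) (inner ℝ (gradient g y) v) 0 := by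
    have h0 : HasFDerivAt g (fderiv ℝ g y) (y + (0 : ℝ) • v) := by
      simpa using (hg.differentiable (by simp) y).hasFDerivAt
    rw [← fderiv_eq_inner_gradient]
    exact h0.comp_hasDerivAt (0 : ℝ) hline
  have h1 := (hasDerivWithinAt_iff_tendsto_slope' (by simp)).1
    (hd.hasDerivWithinAt (s := Ioi 0))
  have h2 : ∀ᶠ t : ℝ in 𝓝[>] 0, slope (fun t : ℝ => g (y + t • v)) 0 t < 0 :=
    h1.eventually_lt_const hv
  filter_upwards [h2, self_mem_nhdsWithin] with t ht htp
  rw [slope_def_field] at ht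
  simp only [zero_smul, add_zero, hy, sub_zero] at ht
  exact (div_neg_iff.1 ht).elim (fun h => absurd h.2 (not_lt.2 (le_of_lt htp))) (fun h => h.1)

/-- An open half space determines its unit normal. An inclusion of half spaces suffices. -/
lemma normalize_eq_of_halfSpace {a b : E3} (ha : a ≠ 0) (hb : b ≠ 0)
    (h : ∀ v, inner ℝ a v < (0 : ℝ) → inner ℝ b v ≤ (0 : ℝ)) : ‖a‖⁻¹ • a = ‖b‖⁻¹ • b := by
  have ha' : 0 < ‖a‖⁻¹ := inv_pos.2 (norm_pos_iff.2 ha)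
  have hb' : 0 < ‖b‖⁻¹ := inv_pos.2 (norm_pos_iff.2 hb)
  have hna : ‖‖a‖⁻¹ • a‖ = 1 := by
    rw [norm_smul, Real.norm_of_nonneg ha'.le, inv_mul_cancel₀ (norm_ne_zero_iff.2 ha)]
  have hnb : ‖‖b‖⁻¹ • b‖ = 1 := by
    rw [norm_smul, Real.norm_of_nonneg hb'.le, inv_mul_cancel₀ (norm_ne_zero_iff.2 hb)]
  set u := ‖a‖⁻¹ • a with hu
  set w := ‖b‖⁻¹ • b with hw
  have h' : ∀ v, inner ℝ u v < (0 : ℝ) → inner ℝ w v ≤ (0 : ℝ) := by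
    intro v hv
    rw [hu, real_inner_smul_left] at hv
    rw [hw, real_inner_smul_left]
    exact mul_nonpos_of_nonneg_of_nonpos hb'.le (h v (by nlinarith))
  by_contra hne
  have hlt : inner ℝ u w < (1 : ℝ) := by
    rw [inner_lt_one_iff_real_of_norm_eq_one hna hnb]; exact hne
  have h3 := h' (w - u) (by
    rw [inner_sub_right, real_inner_self_eq_norm_sq, hna]; linarith)
  rw [inner_sub_right, real_inner_self_eq_norm_sq, hnb, real_inner_comm] at h3
  linarith

namespace ClosedSurface

variable (M : ClosedSurface)

lemma isClosed_carrier : IsClosed M.carrier := isClosed_frontier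

lemma isCompact_carrier : IsCompact M.carrier :=
  Metric.isCompact_of_isClosed_isBounded isClosed_frontier
    (M.isBounded_body.closure.subset frontier_subset_closure)

/-- A smooth function whose negative set is the body near `x`, with nonzero gradient at `x`. -/
def IsDefining (g : E3 → ℝ) (x : E3) : Prop :=
  ContDiff ℝ ∞ g ∧ gradient g x ≠ 0 ∧ ∀ᶠ y in 𝓝 x, y ∈ M.body ↔ g y < 0

variable {M}

lemma IsDefining.eventually {g : E3 → ℝ} {x : E3} (h : M.IsDefining g x) :
    ∀ᶠ y in 𝓝 x, M.IsDefining g y := by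
  obtain ⟨hg, h0, hb⟩ := h
  filter_upwards [hb.eventually_nhds,
    (contDiff_gradient hg).continuous.continuousAt.eventually_ne h0] with y hy hy0
  exact ⟨hg, hy0, hy⟩

lemma IsDefining.eq_zero {g : E3 → ℝ} {x : E3} (h : M.IsDefining g x) (hx : x ∈ M.carrier) :
    g x = 0 := by
  obtain ⟨hg, h0, hb⟩ := h
  have hx1 : x ∉ M.body := by
    have := hx.2
    rwa [M.isOpen_body.interior_eq] at this
  have hx2 : ¬ g x < 0 := fun hlt => hx1 (hb.self_of_nhds.2 hlt)
  have hx3 : ¬ 0 < g x := by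
    intro hpos
    have hev : ∀ᶠ y in 𝓝 x, y ∉ M.body := by
      filter_upwards [hb, hg.continuous.continuousAt.tendsto.eventually_const_lt hpos] with y hy hy2 hyb
      exact absurd (hy.1 hyb) (not_lt.2 hy2.le)
    have hcl : x ∈ closure M.body := hx.1
    rw [mem_closure_iff_frequently] at hcl
    exact hcl hev
  linarith [not_lt.1 hx2, not_lt.1 hx3]

lemma IsDefining.mem_carrier {g : E3 → ℝ} {x : E3} (h : M.IsDefining g x) (hx : g x = 0) :
    x ∈ M.carrier := by
  obtain ⟨hg, h0, hb⟩ := h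
  refine ⟨?_, fun hi => ?_⟩
  · have h1 := eventually_lt_zero_of_inner_gradient_neg hg hx (v := -gradient g x) (by
      rw [inner_neg_right, real_inner_self_eq_norm_sq]
      have := norm_pos_iff.2 h0
      nlinarith)
    have hlim : Tendsto (fun t : ℝ => x + t • -gradient g x) (𝓝[>] 0) (𝓝 x) := by
      have : Continuous fun t : ℝ => x + t • -gradient g x := by fun_prop
      simpa using (this.tendsto 0).mono_left nhdsWithin_le_nhds
    refine mem_closure_of_tendsto hlim ?_
    filter_upwards [h1, hlim.eventually hb] with t ht hb'
    exact hb'.2 ht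
  · have := hb.self_of_nhds.1 (interior_subset hi)
    linarith

/-- The outward unit normal can be computed from any defining function. -/
lemma IsDefining.normal_eq {g : E3 → ℝ} {x : E3} (h : M.IsDefining g x) (hx : x ∈ M.carrier) :
    M.normal x = ‖gradient g x‖⁻¹ • gradient g x := by
  obtain ⟨g', hg', h0', hb', hn⟩ := M.exists_defining_function x hx
  have h' : M.IsDefining g' x := ⟨hg', h0', hb'⟩
  have hz := h.eq_zero hx
  have hz' := h'.eq_zero hx
  obtain ⟨hg, h0, hb⟩ := h
  rw [hn]
  refine normalize_eq_of_halfSpace h0' h0 fun v hv => ?_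
  by_contra hcon
  have hneg := eventually_lt_zero_of_inner_gradient_neg hg' hz' hv
  have hpos := eventually_lt_zero_of_inner_gradient_neg (hg := hg.neg) (y := x) (v := v)
    (by simp [hz]) (by
      rw [← fderiv_eq_inner_gradient, fderiv_fun_neg, neg_apply, fderiv_eq_inner_gradient]
      linarith [not_le.1 hcon])
  have hlim : Tendsto (fun t : ℝ => x + t • v) (𝓝[>] 0) (𝓝 x) := by
    have : Continuous fun t : ℝ => x + t • v := by fun_prop
    simpa using (this.tendsto 0).mono_left nhdsWithin_le_nhds
  obtain ⟨t, h1, h2, h3, h4⟩ :=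
    (hneg.and (hpos.and ((hlim.eventually hb).and (hlim.eventually hb')))).exists
  have := h3.1 (h4.2 h1)
  linarith

lemma exists_isDefining {x : E3} (hx : x ∈ M.carrier) : ∃ g, M.IsDefining g x := by
  obtain ⟨g, hg, h0, hb, -⟩ := M.exists_defining_function x hx
  exact ⟨g, hg, h0, hb⟩

lemma inner_normal_self {x : E3} (hx : x ∈ M.carrier) :
    inner ℝ (M.normal x) (M.normal x) = (1 : ℝ) := by
  obtain ⟨g, hg⟩ := exists_isDefining hx
  have h0 := norm_ne_zero_iff.2 hg.2.1
  rw [hg.normal_eq hx, real_inner_smul_left, real_inner_smul_right, real_inner_self_eq_norm_sq]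
  field_simp

lemma norm_normal {x : E3} (hx : x ∈ M.carrier) : ‖M.normal x‖ = 1 := by
  have h := inner_normal_self hx
  rw [real_inner_self_eq_norm_sq] at h
  nlinarith [norm_nonneg (M.normal x)]

lemma IsDefining.gradient_eq {g : E3 → ℝ} {x : E3} (h : M.IsDefining g x) (hx : x ∈ M.carrier) :
    gradient g x = ‖gradient g x‖ • M.normal x := by
  rw [h.normal_eq hx, smul_smul, mul_inv_cancel₀ (norm_ne_zero_iff.2 h.2.1), one_smul]

lemma mem_tangentPlane {x v : E3} : v ∈ M.tangentPlane x ↔ inner ℝ (M.normal x) v = (0 : ℝ) :=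
  Submodule.mem_orthogonal_singleton_iff_inner_right

/-- The orthogonal projection onto the tangent plane, in terms of the unit normal. -/
lemma starProjection_tangentPlane {x : E3} (hx : x ∈ M.carrier) (v : E3) :
    (M.tangentPlane x).starProjection v = v - (inner ℝ (M.normal x) v : ℝ) • M.normal x := by
  unfold tangentPlane
  rw [Submodule.starProjection_orthogonal_val, Submodule.starProjection_unit_singleton ℝ
    (norm_normal hx)]

/-- A chart around a point of the surface in which the surface is a plane. -/
lemma IsDefining.exists_flattening {g : E3 → ℝ} {x : E3} (h : M.IsDefining g x)
    (hx : x ∈ M.carrier) :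
    ∃ e : OpenPartialHomeomorph E3 E3, x ∈ e.source ∧
      (∀ y, e y = (y - x) + (g y - inner ℝ (M.normal x) (y - x)) • M.normal x) ∧
      e x = 0 ∧ ContDiffAt ℝ ∞ e.symm 0 ∧
      ∀ v ∈ M.tangentPlane x, HasDerivAt (fun t : ℝ => e.symm (t • v)) v 0 := by
  set n := M.normal x with hn
  have hnn : inner ℝ n n = (1 : ℝ) := inner_normal_self hx
  let Φ : E3 → E3 := fun y => (y - x) + (g y - inner ℝ n (y - x)) • n
  have hΦ : ContDiff ℝ ∞ Φ := by
    have h1 : ContDiff ℝ ∞ fun y : E3 => y - x := contDiff_id.sub contDiff_const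
    exact h1.add ((h.1.sub (contDiff_const.inner ℝ h1)).smul contDiff_const)
  let A : E3 →L[ℝ] E3 := ContinuousLinearMap.id ℝ E3 +
    (fderiv ℝ g x - innerSL ℝ n).smulRight n
  have hA : HasFDerivAt Φ A x := by
    have h1 : HasFDerivAt (fun y : E3 => y - x) (ContinuousLinearMap.id ℝ E3) x :=
      (hasFDerivAt_id x).sub_const x
    have h2 : HasFDerivAt (fun y : E3 => inner ℝ n (y - x)) (innerSL ℝ n) x :=
      (innerSL ℝ n).hasFDerivAt.comp x h1
    exact h1.add ((((h.1.differentiable (by simp) x).hasFDerivAt).sub h2).smul_const n)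
  have hAv : ∀ v, A v = v + (‖gradient g x‖ * inner ℝ n v - inner ℝ n v) • n := by
    intro v
    have : fderiv ℝ g x v = ‖gradient g x‖ * inner ℝ n v := by
      rw [fderiv_eq_inner_gradient, h.gradient_eq hx, real_inner_smul_left,
        ← h.gradient_eq hx]
    simp [A, this]
  have hc := norm_pos_iff.2 h.2.1
  have hinj : ∀ v, A v = 0 → v = 0 := by
    intro v hv
    rw [hAv] at hv
    have h1 : (inner ℝ n (v + (‖gradient g x‖ * inner ℝ n v - inner ℝ n v) • n) : ℝ) = 0 := by
      rw [hv, inner_zero_right]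
    rw [inner_add_right, real_inner_smul_right, hnn] at h1
    have h2 : inner ℝ n v = (0 : ℝ) := by
      have : ‖gradient g x‖ * inner ℝ n v = (0 : ℝ) := by linarith
      exact (mul_eq_zero.1 this).resolve_left hc.ne'
    simpa [h2] using hv
  have hΦx : Φ x = 0 := by simp [Φ, h.eq_zero hx]
  obtain ⟨e, he, hxe, hs, B, hB, hBA⟩ := exists_chart hΦ hA hinj
  rw [hΦx] at hs hB
  refine ⟨e, hxe, fun y => by rw [he], by rw [he, hΦx], hs, fun v hv => ?_⟩
  have hBv : B v = v := by
    have : A v = v := by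
      rw [hAv, mem_tangentPlane.1 hv]; simp
    simpa [this] using hBA v
  have h1 : HasDerivAt (fun t : ℝ => t • v) v 0 := by
    simpa using (hasDerivAt_id (0 : ℝ)).smul_const v
  have h2 : HasFDerivAt e.symm B ((0 : ℝ) • v) := by simpa using hB
  have h3 := h2.comp_hasDerivAt (0 : ℝ) h1
  rw [hBv] at h3
  exact h3

/-- Every tangent vector is the velocity of a curve in the surface. -/
lemma exists_curve {x v : E3} (hx : x ∈ M.carrier) (hv : v ∈ M.tangentPlane x) :
    ∃ c : ℝ → E3, c 0 = x ∧ HasDerivAt c v 0 ∧ ∀ᶠ t in 𝓝 0, c t ∈ M.carrier := by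
  obtain ⟨g, hg⟩ := exists_isDefining hx
  obtain ⟨e, hxe, he, hex, hs, hd⟩ := hg.exists_flattening hx
  have h0 : e.symm 0 = x := by rw [← hex, e.left_inv hxe]
  have hc := hd v hv
  refine ⟨fun t => e.symm (t • v), by simp [h0], hc, ?_⟩
  have hlim : Tendsto (fun t : ℝ => e.symm (t • v)) (𝓝 0) (𝓝 x) := by
    simpa [h0] using hc.continuousAt.tendsto
  have ht : Tendsto (fun t : ℝ => t • v) (𝓝 0) (𝓝 (0 : E3)) := by
    have : Continuous fun t : ℝ => t • v := by fun_prop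
    simpa using this.tendsto 0
  have htar : e.target ∈ 𝓝 (0 : E3) :=
    e.open_target.mem_nhds (by rw [← hex]; exact e.map_source hxe)
  filter_upwards [hlim.eventually hg.eventually, ht.eventually htar] with t h1 h2
  refine h1.mem_carrier ?_
  have h3 := he (e.symm (t • v))
  rw [e.right_inv h2] at h3
  have h4 := congrArg (fun u => (inner ℝ (M.normal x) u : ℝ)) h3
  simp only [inner_add_right, real_inner_smul_right, inner_normal_self hx,
    mem_tangentPlane.1 hv] at h4
  linarith

variable {F : Type*} [NormedAddCommGroup F] [NormedSpace ℝ F]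

/-! ### Differentiation along the surface -/

/-- Derivatives within the surface are determined on the tangent plane, although the surface is not
a set of unique differentiability in space. -/
lemma hasFDerivWithinAt_unique {h : E3 → F} {A B : E3 →L[ℝ] F} {x v : E3} (hx : x ∈ M.carrier)
    (hA : HasFDerivWithinAt h A M.carrier x) (hB : HasFDerivWithinAt h B M.carrier x)
    (hv : v ∈ M.tangentPlane x) : A v = B v := by
  obtain ⟨c, hc0, hc, hcM⟩ := exists_curve hx hv
  subst hc0
  exact (hA.comp_hasDerivAt 0 hc hcM).unique (hB.comp_hasDerivAt 0 hc hcM)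

lemma surfaceGradient_mem (h : E3 → ℝ) (x : E3) : M.surfaceGradient h x ∈ M.tangentPlane x :=
  Submodule.starProjection_apply_mem _ _

lemma inner_surfaceGradient {h : E3 → ℝ} {A : E3 →L[ℝ] ℝ} {x v : E3} (hx : x ∈ M.carrier)
    (hA : HasFDerivWithinAt h A M.carrier x) (hv : v ∈ M.tangentPlane x) :
    inner ℝ (M.surfaceGradient h x) v = A v := by
  unfold surfaceGradient
  rw [Submodule.inner_starProjection_left_eq_right, Submodule.starProjection_eq_self_iff.2 hv,
    gradientWithin, InnerProductSpace.toDual_symm_apply]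
  exact hasFDerivWithinAt_unique hx hA.differentiableWithinAt.hasFDerivWithinAt hA hv

lemma eq_of_inner_tangent {x a b : E3} (ha : a ∈ M.tangentPlane x) (hb : b ∈ M.tangentPlane x)
    (hab : ∀ v ∈ M.tangentPlane x, inner ℝ a v = (inner ℝ b v : ℝ)) : a = b := by
  have h := hab (a - b) (Submodule.sub_mem _ ha hb)
  rw [← sub_eq_zero, ← inner_sub_left, inner_self_eq_zero, sub_eq_zero] at h
  exact h

lemma surfaceGradient_congr {h k : E3 → ℝ} {x : E3} (hx : x ∈ M.carrier)
    (hk : EqOn h k M.carrier) : M.surfaceGradient h x = M.surfaceGradient k x := by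
  unfold surfaceGradient gradientWithin
  rw [fderivWithin_congr hk (hk hx)]

/-- The gradient of a function that agrees on the surface near `x` with a function `H` on space. -/
lemma surfaceGradient_eq {h H : E3 → ℝ} {x : E3} (hx : x ∈ M.carrier)
    (hH : DifferentiableAt ℝ H x) (heq : ∀ᶠ y in 𝓝 x, y ∈ M.carrier → h y = H y) :
    M.surfaceGradient h x =
      gradient H x - (inner ℝ (M.normal x) (gradient H x) : ℝ) • M.normal x := by
  have hA : HasFDerivWithinAt h (fderiv ℝ H x) M.carrier x := by
    refine hH.hasFDerivAt.hasFDerivWithinAt.congr_of_eventuallyEq ?_ (heq.self_of_nhds hx)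
    exact eventually_nhdsWithin_iff.2 heq
  rw [← starProjection_tangentPlane hx]
  refine eq_of_inner_tangent (surfaceGradient_mem h x) (Submodule.starProjection_apply_mem _ _)
    fun v hv => ?_
  rw [inner_surfaceGradient hx hA hv, Submodule.inner_starProjection_left_eq_right,
    Submodule.starProjection_eq_self_iff.2 hv, fderiv_eq_inner_gradient]

/-- The divergence is the trace of the derivative with its normal-normal entry removed. -/
lemma surfaceDivergence_eq {V : E3 → E3} {L : E3 →L[ℝ] E3} {x : E3} (hx : x ∈ M.carrier)
    (hL : HasFDerivWithinAt V L M.carrier x) :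
    M.surfaceDivergence V x =
      LinearMap.trace ℝ E3 L.toLinearMap - inner ℝ (M.normal x) (L (M.normal x)) := by
  set T := M.tangentPlane x with hT
  set n := M.normal x with hn
  have h1 : M.tangentialDerivative V x =
      T.orthogonalProjectionOnto.toLinearMap ∘ₗ (L.toLinearMap ∘ₗ T.subtype) := by
    ext v : 1
    have : fderivWithin ℝ V M.carrier x v = L v :=
      hasFDerivWithinAt_unique hx hL.differentiableWithinAt.hasFDerivWithinAt hL v.2
    simp [tangentialDerivative, this, T]
  have h2 : T.subtype ∘ₗ T.orthogonalProjectionOnto.toLinearMap =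
      LinearMap.id - (InnerProductSpace.rankOne ℝ n n).toLinearMap := by
    ext v : 1
    have := starProjection_tangentPlane hx v
    simpa using this
  rw [surfaceDivergence, h1, ← LinearMap.trace_comp_comm', LinearMap.comp_assoc, h2,
    LinearMap.comp_sub, map_sub, LinearMap.comp_id]
  congr 1
  rw [← ContinuousLinearMap.toLinearMap_comp]
  have h3 : L ∘L InnerProductSpace.rankOne ℝ n n = InnerProductSpace.rankOne ℝ (L n) n := by
    ext v : 1
    simp
  rw [h3, InnerProductSpace.trace_rankOne]

/-! ### Smooth functions on the surface -/

variable (M) in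
/-- A function that near each point of the surface is the restriction of a smooth function. The
values off the surface play no role. In this local form smoothness passes from a function to its
gradient and its Laplacian, which are given in terms of local defining functions. -/
def LocallySmooth (q : E3 → F) : Prop :=
  ∀ x ∈ M.carrier, ∃ Q : E3 → F,
    ∀ᶠ y in 𝓝 x, ContDiffAt ℝ ∞ Q y ∧ (y ∈ M.carrier → q y = Q y)

lemma Smooth.locallySmooth {h : E3 → ℝ} (hh : M.Smooth h) : M.LocallySmooth h := by
  obtain ⟨H, hH, heq⟩ := hh
  exact fun x _ => ⟨H, Eventually.of_forall fun y => ⟨hH.contDiffAt, fun hy => heq hy⟩⟩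

lemma LocallySmooth.exists_hasFDerivWithinAt {q : E3 → F} (hq : M.LocallySmooth q) {x : E3}
    (hx : x ∈ M.carrier) : ∃ A : E3 →L[ℝ] F, HasFDerivWithinAt q A M.carrier x := by
  obtain ⟨Q, hQ⟩ := hq x hx
  refine ⟨fderiv ℝ Q x, ?_⟩
  refine (hQ.self_of_nhds.1.differentiableAt (by simp)).hasFDerivAt.hasFDerivWithinAt
    |>.congr_of_eventuallyEq ?_ (hQ.self_of_nhds.2 hx)
  exact eventually_nhdsWithin_iff.2 (hQ.mono fun y hy => hy.2)

lemma LocallySmooth.continuousOn {q : E3 → F} (hq : M.LocallySmooth q) :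
    ContinuousOn q M.carrier := fun _ hx =>
  let ⟨_, hA⟩ := hq.exists_hasFDerivWithinAt hx
  hA.continuousWithinAt

lemma locallySmooth_normal : M.LocallySmooth M.normal := by
  intro x hx
  obtain ⟨g, hg⟩ := exists_isDefining hx
  refine ⟨fun y => ‖gradient g y‖⁻¹ • gradient g y, ?_⟩
  filter_upwards [hg.eventually] with y hy
  refine ⟨?_, fun hyM => hy.normal_eq hyM⟩
  have h1 : ContDiffAt ℝ ∞ (gradient g) y := (contDiff_gradient hy.1).contDiffAt
  exact ((h1.norm ℝ hy.2.1).inv (norm_ne_zero_iff.2 hy.2.1)).smul h1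

lemma locallySmooth_chi : M.LocallySmooth M.chi := by
  intro x hx
  obtain ⟨N, hN⟩ := locallySmooth_normal x hx
  refine ⟨fun y => N y 2, hN.mono fun y hy => ⟨?_, fun hyM => by simp [chi, hy.2 hyM]⟩⟩
  exact contDiffAt_euclidean.1 hy.1 2

lemma LocallySmooth.sub_const_mul {p q : E3 → ℝ} (hp : M.LocallySmooth p)
    (hq : M.LocallySmooth q) (c : ℝ) : M.LocallySmooth (fun y => p y - c * q y) := by
  intro x hx
  obtain ⟨P, hP⟩ := hp x hx
  obtain ⟨Q, hQ⟩ := hq x hx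
  refine ⟨fun y => P y - c * Q y, ?_⟩
  filter_upwards [hP, hQ] with y h1 h2
  exact ⟨h1.1.sub (contDiffAt_const.mul h2.1), fun hy => by rw [h1.2 hy, h2.2 hy]⟩

lemma LocallySmooth.surfaceGradient {h : E3 → ℝ} (hh : M.LocallySmooth h) :
    M.LocallySmooth (M.surfaceGradient h) := by
  intro x hx
  obtain ⟨H, hH⟩ := hh x hx
  obtain ⟨N, hN⟩ := locallySmooth_normal x hx
  refine ⟨fun y => gradient H y - (inner ℝ (N y) (gradient H y) : ℝ) • N y, ?_⟩
  filter_upwards [hH.eventually_nhds, hN] with y h1 h2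
  have hy := h1.self_of_nhds
  have hg : ContDiffAt ℝ ∞ (gradient H) y :=
    (InnerProductSpace.toDual ℝ E3).symm.toContinuousLinearEquiv.contDiff.contDiffAt.comp y
      (hy.1.fderiv_right (m := ∞) (by simp))
  refine ⟨hg.sub ((h2.1.inner ℝ hg).smul h2.1), fun hyM => ?_⟩
  rw [surfaceGradient_eq hyM (hy.1.differentiableAt (by simp)) (h1.mono fun z hz => hz.2),
    h2.2 hyM]

lemma LocallySmooth.laplacian {h : E3 → ℝ} (hh : M.LocallySmooth h) :
    M.LocallySmooth (M.laplacian h) := by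
  intro x hx
  obtain ⟨V, hV⟩ := hh.surfaceGradient x hx
  obtain ⟨N, hN⟩ := locallySmooth_normal x hx
  let tr : (E3 →L[ℝ] E3) →L[ℝ] ℝ :=
    ((LinearMap.trace ℝ E3) ∘ₗ (ContinuousLinearMap.coeLM ℝ)).toContinuousLinearMap
  refine ⟨fun y => tr (fderiv ℝ V y) - inner ℝ (N y) (fderiv ℝ V y (N y)), ?_⟩
  filter_upwards [hV.eventually_nhds, hN] with y h1 h2
  have hy := h1.self_of_nhds
  have hd : ContDiffAt ℝ ∞ (fderiv ℝ V) y := hy.1.fderiv_right (m := ∞) (by simp)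
  refine ⟨(tr.contDiff.contDiffAt.comp y hd).sub (h2.1.inner ℝ (hd.clm_apply h2.1)),
    fun hyM => ?_⟩
  have hL : HasFDerivWithinAt (M.surfaceGradient h) (fderiv ℝ V y) M.carrier y := by
    refine (hy.1.differentiableAt (by simp)).hasFDerivAt.hasFDerivWithinAt
      |>.congr_of_eventuallyEq ?_ (hy.2 hyM)
    exact eventually_nhdsWithin_iff.2 (h1.mono fun z hz => hz.2)
  rw [ClosedSurface.laplacian, surfaceDivergence_eq hyM hL, h2.2 hyM]
  rfl

/-! ### Rotations of the surface -/

lemma IsRotationInvariant.mem_iff (hrot : M.IsRotationInvariant) (s : ℝ) (x : E3) :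
    axisRotation s x ∈ M.carrier ↔ x ∈ M.carrier :=
  ⟨fun h => by simpa using hrot (-s) _ h, hrot s x⟩

/-- The body is invariant because an orbit that avoids its boundary cannot leave it. -/
lemma IsRotationInvariant.body_mem (hrot : M.IsRotationInvariant) (s : ℝ) {x : E3}
    (hx : x ∈ M.body) : axisRotation s x ∈ M.body := by
  have hc : Continuous fun t : ℝ => axisRotation t x :=
    continuous_iff_continuousAt.2 fun t => (hasDerivAt_axisRotation t x).continuousAt
  have hxM : x ∉ M.carrier := fun h => by
    have := h.2
    rw [M.isOpen_body.interior_eq] at this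
    exact this hx
  have hcl : IsClopen ((fun t : ℝ => axisRotation t x) ⁻¹' M.body) := by
    refine ⟨?_, M.isOpen_body.preimage hc⟩
    have : (fun t : ℝ => axisRotation t x) ⁻¹' M.body =
        (fun t : ℝ => axisRotation t x) ⁻¹' closure M.body := by
      refine Subset.antisymm (preimage_mono subset_closure) fun t ht => ?_
      by_contra hcon
      refine hxM ((hrot.mem_iff t x).1 ⟨ht, fun hi => hcon (interior_subset (s := M.body) hi)⟩)
    rw [this]
    exact isClosed_closure.preimage hc
  have := hcl.eq_univ ⟨0, by simpa using hx⟩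
  exact (this ▸ mem_univ s : s ∈ (fun t : ℝ => axisRotation t x) ⁻¹' M.body)

lemma IsRotationInvariant.body_mem_iff (hrot : M.IsRotationInvariant) (s : ℝ) (x : E3) :
    axisRotation s x ∈ M.body ↔ x ∈ M.body :=
  ⟨fun h => by simpa using hrot.body_mem (-s) h, hrot.body_mem s⟩

lemma gradient_comp_axisRotation {g : E3 → ℝ} (hg : ContDiff ℝ ∞ g) (s : ℝ) (x : E3) :
    gradient (fun y => g (axisRotation (-s) y)) (axisRotation s x) =
      axisRotation s (gradient g x) := by
  refine ext_inner_right ℝ fun v => ?_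
  have h1 : HasFDerivAt g (fderiv ℝ g x) (axisRotation (-s) (axisRotation s x)) := by
    simpa using (hg.differentiable (by simp) x).hasFDerivAt
  have h2 := h1.comp (axisRotation s x) (hasFDerivAt_axisRotation (-s) (axisRotation s x))
  rw [← fderiv_eq_inner_gradient]
  have h3 : fderiv ℝ (fun y => g (axisRotation (-s) y)) (axisRotation s x) v =
      fderiv ℝ g x (axisRotation (-s) v) := by
    rw [HasFDerivAt.fderiv (f := fun y => g (axisRotation (-s) y)) h2]
    rfl
  rw [h3, fderiv_eq_inner_gradient, ← inner_axisRotation s]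
  simp

lemma IsRotationInvariant.normal (hrot : M.IsRotationInvariant) (s : ℝ) {x : E3}
    (hx : x ∈ M.carrier) : M.normal (axisRotation s x) = axisRotation s (M.normal x) := by
  obtain ⟨g, hg⟩ := exists_isDefining hx
  have hg' : M.IsDefining (fun y => g (axisRotation (-s) y)) (axisRotation s x) := by
    refine ⟨hg.1.comp (contDiff_axisRotation (-s)), ?_, ?_⟩
    · rw [gradient_comp_axisRotation hg.1, ← norm_ne_zero_iff, norm_axisRotation,
        norm_ne_zero_iff]
      exact hg.2.1
    · have hlim : Tendsto (axisRotation (-s)) (𝓝 (axisRotation s x)) (𝓝 x) := by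
        simpa using (contDiff_axisRotation (-s)).continuous.tendsto (axisRotation s x)
      filter_upwards [hlim.eventually hg.2.2] with y hy
      rw [← hy, hrot.body_mem_iff]
  rw [hg'.normal_eq (hrot s x hx), gradient_comp_axisRotation hg.1, norm_axisRotation,
    hg.normal_eq hx]
  exact ((rotationEquiv s).map_smul _ _).symm

lemma IsRotationInvariant.mem_tangentPlane (hrot : M.IsRotationInvariant) (s : ℝ) {x v : E3}
    (hx : x ∈ M.carrier) :
    axisRotation s v ∈ M.tangentPlane (axisRotation s x) ↔ v ∈ M.tangentPlane x := by
  rw [ClosedSurface.mem_tangentPlane, ClosedSurface.mem_tangentPlane, hrot.normal s hx,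
    inner_axisRotation]

lemma IsRotationInvariant.chi (hrot : M.IsRotationInvariant) (s : ℝ) {x : E3}
    (hx : x ∈ M.carrier) : M.chi (axisRotation s x) = M.chi x := by
  simp [ClosedSurface.chi, hrot.normal s hx]

lemma IsRotationInvariant.rotationField_mem (hrot : M.IsRotationInvariant) {x : E3}
    (hx : x ∈ M.carrier) : rotationField x ∈ M.tangentPlane x := by
  obtain ⟨g, hg⟩ := exists_isDefining hx
  have hc : HasDerivAt (fun t => axisRotation t x) (rotationField x) 0 := by
    simpa using hasDerivAt_axisRotation 0 x
  have hlim : Tendsto (fun t => axisRotation t x) (𝓝 0) (𝓝 x) := by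
    simpa using hc.continuousAt.tendsto
  have h1 : HasFDerivAt g (fderiv ℝ g x) (axisRotation 0 x) := by
    simpa using (hg.1.differentiable (by simp) x).hasFDerivAt
  have h2 := h1.comp_hasDerivAt (0 : ℝ) hc
  have h3 : HasDerivAt (g ∘ fun t => axisRotation t x) 0 0 := by
    refine (hasDerivAt_const (0 : ℝ) (0 : ℝ)).congr_of_eventuallyEq ?_
    filter_upwards [hlim.eventually hg.eventually] with t ht
    exact ht.eq_zero (hrot t x hx)
  have h4 := h2.unique h3
  rw [fderiv_eq_inner_gradient, hg.gradient_eq hx, real_inner_smul_left] at h4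
  exact ClosedSurface.mem_tangentPlane.2
    ((mul_eq_zero.1 h4).resolve_left (norm_ne_zero_iff.2 hg.2.1))

lemma hasFDerivWithinAt_comp_rotation (hrot : M.IsRotationInvariant) {h : E3 → F}
    {A : E3 →L[ℝ] F} (s : ℝ) {x : E3}
    (hA : HasFDerivWithinAt h A M.carrier (axisRotation s x)) :
    HasFDerivWithinAt (fun y => h (axisRotation s y))
      (A ∘L ((rotationEquiv s).toContinuousLinearEquiv : E3 →L[ℝ] E3)) M.carrier x :=
  hA.comp x (hasFDerivAt_axisRotation s x).hasFDerivWithinAt fun _ hy => hrot s _ hy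

lemma LocallySmooth.surfaceGradient_comp_rotation (hrot : M.IsRotationInvariant) {h : E3 → ℝ}
    (hh : M.LocallySmooth h) (s : ℝ) {x : E3} (hx : x ∈ M.carrier) :
    axisRotation s (M.surfaceGradient (fun y => h (axisRotation s y)) x) =
      M.surfaceGradient h (axisRotation s x) := by
  obtain ⟨A, hA⟩ := hh.exists_hasFDerivWithinAt (hrot s x hx)
  refine eq_of_inner_tangent ((hrot.mem_tangentPlane s hx).2 (surfaceGradient_mem _ _))
    (surfaceGradient_mem _ _) fun v hv => ?_
  have hv' : axisRotation (-s) v ∈ M.tangentPlane x := by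
    rw [← hrot.mem_tangentPlane s hx]; simpa using hv
  rw [inner_surfaceGradient (hrot s x hx) hA hv]
  conv_lhs => rw [← axisRotation_axisRotation_neg s v]
  rw [inner_axisRotation, inner_surfaceGradient hx (hasFDerivWithinAt_comp_rotation hrot s hA) hv']
  simp

lemma LocallySmooth.surfaceGradient_rotation (hrot : M.IsRotationInvariant) {h : E3 → ℝ}
    (hh : M.LocallySmooth h) (hinv : ∀ s, ∀ x ∈ M.carrier, h (axisRotation s x) = h x)
    (s : ℝ) {x : E3} (hx : x ∈ M.carrier) :
    M.surfaceGradient h (axisRotation s x) = axisRotation s (M.surfaceGradient h x) := by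
  rw [← hh.surfaceGradient_comp_rotation hrot s hx]
  exact congrArg _ (surfaceGradient_congr hx fun y hy => hinv s y hy)

lemma LocallySmooth.laplacian_rotation (hrot : M.IsRotationInvariant) {h : E3 → ℝ}
    (hh : M.LocallySmooth h) (hinv : ∀ s, ∀ x ∈ M.carrier, h (axisRotation s x) = h x)
    (s : ℝ) {x : E3} (hx : x ∈ M.carrier) :
    M.laplacian h (axisRotation s x) = M.laplacian h x := by
  obtain ⟨L, hL⟩ := hh.surfaceGradient.exists_hasFDerivWithinAt (hrot s x hx)
  let R := (rotationEquiv s).toContinuousLinearEquiv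
  have h1 : HasFDerivWithinAt (fun y => axisRotation (-s) (M.surfaceGradient h (axisRotation s y)))
      ((R.symm : E3 →L[ℝ] E3) ∘L (L ∘L (R : E3 →L[ℝ] E3))) M.carrier x :=
    (R.symm.hasFDerivAt).comp_hasFDerivWithinAt x (hasFDerivWithinAt_comp_rotation hrot s hL)
  have h2 : HasFDerivWithinAt (M.surfaceGradient h)
      ((R.symm : E3 →L[ℝ] E3) ∘L (L ∘L (R : E3 →L[ℝ] E3))) M.carrier x := by
    refine h1.congr (fun y hy => ?_) ?_
    · beta_reduce; rw [hh.surfaceGradient_rotation hrot hinv s hy]; simp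
    · rw [hh.surfaceGradient_rotation hrot hinv s hx]; simp
  rw [ClosedSurface.laplacian, ClosedSurface.laplacian, surfaceDivergence_eq (hrot s x hx) hL,
    surfaceDivergence_eq hx h2, hrot.normal s hx]
  congr 1
  · have : ((R.symm : E3 →L[ℝ] E3) ∘L (L ∘L (R : E3 →L[ℝ] E3))).toLinearMap =
        R.symm.toLinearEquiv.conj L.toLinearMap := by
      ext v : 1; rfl
    rw [this, LinearMap.trace_conj']
  · rw [← inner_axisRotation s (M.normal x)]
    congr 1
    exact (axisRotation_axisRotation_neg s _).symm

/-- Zonal functions are invariant under the rotations. -/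
lemma IsZonal.rotation_eq (hrot : M.IsRotationInvariant) {f : E3 → ℝ} (hf : M.IsZonal f) (s : ℝ)
    {x : E3} (hx : x ∈ M.carrier) : f (axisRotation s x) = f x := by
  have hd : ∀ t, HasDerivAt (fun t => f (axisRotation t x)) 0 t := by
    intro t
    obtain ⟨A, hA⟩ := hf.1.locallySmooth.exists_hasFDerivWithinAt (hrot t x hx)
    have h1 := hA.comp_hasDerivAt t (hasDerivAt_axisRotation t x)
      (Eventually.of_forall fun u => hrot u x hx)
    rw [← inner_surfaceGradient (hrot t x hx) hA (hrot.rotationField_mem (hrot t x hx)),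
      real_inner_comm, hf.2 _ (hrot t x hx)] at h1
    exact h1
  have := is_const_of_deriv_eq_zero (fun t => (hd t).differentiableAt) (fun t => (hd t).deriv) s 0
  simpa using this

/-! ### The rotation potential -/

/-- The expansion of `w` in the orthogonal basis `u`, `n × u` of the plane orthogonal to `n`. -/
lemma expansion_of_orthogonal {n u w : E3} (hn : inner ℝ n n = (1 : ℝ))
    (hu : inner ℝ n u = (0 : ℝ)) (hw : inner ℝ n w = (0 : ℝ)) :
    (inner ℝ u w : ℝ) • u + (inner ℝ (cross n u) w : ℝ) • cross n u = (inner ℝ u u : ℝ) • w := by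
  -- A polynomial identity; its right-hand side collects the defects of the three hypotheses.
  have key : ∀ i, (inner ℝ u u : ℝ) * w i - inner ℝ u w * u i - inner ℝ (cross n u) w * cross n u i
      = (1 - inner ℝ n n) * cross (cross u w) u i - inner ℝ n w * cross (cross n u) u i +
        inner ℝ n u * cross (cross n w) u i := by
    intro i
    fin_cases i <;> simp only [inner_E3, cross_zero, cross_one, cross_two, Fin.zero_eta,
      Fin.mk_one, Fin.reduceFinMk] <;> ring
  ext i
  have h := key i
  rw [hn, hu, hw] at h
  simp only [PiLp.add_apply, PiLp.smul_apply, smul_eq_mul]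
  linarith

lemma J_J {x v : E3} (hx : x ∈ M.carrier) (hv : v ∈ M.tangentPlane x) :
    M.J x (M.J x v) = -v :=
  cross_cross (inner_normal_self hx) (mem_tangentPlane.1 hv)

lemma IsRotationPotential.surfaceGradient_eq {ξ : E3 → ℝ} (hξ : M.IsRotationPotential ξ) {x : E3}
    (hx : x ∈ M.carrier) : M.surfaceGradient ξ x = M.J x (rotationField x) := by
  have h := J_J hx (surfaceGradient_mem ξ x)
  rw [hξ.2 x hx, J, cross_neg, neg_inj] at h
  exact h.symm

lemma IsRotationPotential.isZonal {ξ : E3 → ℝ} (hξ : M.IsRotationPotential ξ) : M.IsZonal ξ :=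
  ⟨hξ.1, fun x hx => by rw [hξ.surfaceGradient_eq hx]; exact inner_cross_right _ _⟩

/-- The squared distance to the axis of rotation. -/
def axisDistSq (x : E3) : ℝ := x 0 ^ 2 + x 1 ^ 2

lemma inner_rotationField_self (x : E3) :
    inner ℝ (rotationField x) (rotationField x) = axisDistSq x := by
  simp only [inner_E3, axisDistSq, rotationField_zero, rotationField_one, rotationField_two]
  ring

/-- The length of `∇ξ` is the distance to the axis. -/
lemma IsRotationPotential.inner_self {ξ : E3 → ℝ} (hrot : M.IsRotationInvariant)
    (hξ : M.IsRotationPotential ξ) {x : E3} (hx : x ∈ M.carrier) :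
    inner ℝ (M.surfaceGradient ξ x) (M.surfaceGradient ξ x) = axisDistSq x := by
  rw [hξ.surfaceGradient_eq hx, J, inner_cross_cross (inner_normal_self hx)
    (mem_tangentPlane.1 (hrot.rotationField_mem hx)), inner_rotationField_self]

end ClosedSurface

/-! ### A criterion for global injectivity -/

/-- The inverse of a continuous injective function on a compact set is continuous. -/
lemma continuousOn_of_leftInverse {X Y : Type*} [TopologicalSpace X] [TopologicalSpace Y]
    [T2Space Y] {K : Set X} (hK : IsCompact K) {f : X → Y} (hf : ContinuousOn f K) {g : Y → X}
    (hg : ∀ x ∈ K, g (f x) = x) : ContinuousOn g (f '' K) := by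
  rw [continuousOn_iff_isClosed]
  intro C hC
  refine ⟨f '' (K ∩ C), ((hK.inter_right hC).image_of_continuousOn
    (hf.mono inter_subset_left)).isClosed, ?_⟩
  ext y
  constructor
  · rintro ⟨h1, x, hx, rfl⟩
    exact ⟨⟨x, ⟨hx, by simpa [hg x hx] using h1⟩, rfl⟩, x, hx, rfl⟩
  · rintro ⟨⟨x, ⟨hx, hxC⟩, rfl⟩, -⟩
    exact ⟨by simpa [hg x hx] using hxC, x, hx, rfl⟩

/-- A function on a connected Hausdorff space is injective if near each point it has a continuous
local inverse on an interval. The interval may be half-open, so that local extrema are allowed.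

Two points are related if a section of `ψ` over a compact interval joins them. Sections that meet
agree where both are defined, so this relation is transitive; its classes are open. -/
theorem injective_of_local_sections {X : Type*} [TopologicalSpace X] [T2Space X]
    [PreconnectedSpace X] {ψ : X → ℝ}
    (h : ∀ x, ∃ U ∈ 𝓝 x, ∃ c : ℝ → X, (∀ y ∈ U, c (ψ y) = y) ∧ ContinuousOn c (ψ '' U) ∧
      (ψ '' U).OrdConnected) : Function.Injective ψ := by
  have hloc : IsLocallyInjective ψ := by
    intro x
    obtain ⟨U, hU, c, hc, -⟩ := h x
    refine ⟨interior U, isOpen_interior, mem_interior_iff_mem_nhds.2 hU, fun a ha b hb hab => ?_⟩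
    rw [← hc a (interior_subset ha), hab, hc b (interior_subset hb)]
  let R : X → X → Prop := fun x y => ∃ c : ℝ → X, ContinuousOn c (uIcc (ψ x) (ψ y)) ∧
    (∀ t ∈ uIcc (ψ x) (ψ y), ψ (c t) = t) ∧ c (ψ x) = x ∧ c (ψ y) = y
  have hR : ∀ x y, R x y := by
    have : Std.Symm R := ⟨fun x y ⟨c, h1, h2, h3, h4⟩ => ⟨c, by rwa [uIcc_comm],
      by rwa [uIcc_comm], h4, h3⟩⟩
    refine PreconnectedSpace.induction₂ R (fun x => ?_) ⟨?_⟩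
    · obtain ⟨U, hU, c, hc, hcont, hord⟩ := h x
      filter_upwards [hU] with y hy
      have hxU := mem_of_mem_nhds hU
      have hsub : uIcc (ψ x) (ψ y) ⊆ ψ '' U :=
        hord.uIcc_subset (mem_image_of_mem _ hxU) (mem_image_of_mem _ hy)
      refine ⟨c, hcont.mono hsub, fun t ht => ?_, hc x hxU, hc y hy⟩
      obtain ⟨z, hz, rfl⟩ := hsub ht
      rw [hc z hz]
    · rintro x y z ⟨c, hc1, hc2, hcx, hcy⟩ ⟨d, hd1, hd2, hdy, hdz⟩
      set K := uIcc (ψ x) (ψ y)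
      set L := uIcc (ψ y) (ψ z)
      have hpre : IsPreconnected (K ∩ L) :=
        (ordConnected_uIcc.inter ordConnected_uIcc).isPreconnected
      have hEq : EqOn c d (K ∩ L) :=
        (T2Space.isSeparatedMap ψ).eqOn_of_comp_eqOn hloc hpre (hc1.mono inter_subset_left)
          (hd1.mono inter_subset_right)
          (fun t ht => by simp only [Function.comp_apply, hc2 t ht.1, hd2 t ht.2])
          (⟨right_mem_uIcc, left_mem_uIcc⟩ : ψ y ∈ K ∩ L) (hcy.trans hdy.symm)
      classical
      let e : ℝ → X := fun t => if t ∈ K then c t else d t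
      have heK : EqOn e c K := fun t ht => if_pos ht
      have heL : EqOn e d L := fun t ht => by
        by_cases htK : t ∈ K
        · rw [heK htK, hEq ⟨htK, ht⟩]
        · exact if_neg htK
      have hsub : uIcc (ψ x) (ψ z) ⊆ K ∪ L := uIcc_subset_uIcc_union_uIcc
      refine ⟨e, ?_, fun t ht => ?_, ?_, ?_⟩
      · exact ((hc1.congr heK).union_of_isClosed (hd1.congr heL) isClosed_Icc isClosed_Icc).mono hsub
      · rcases hsub ht with hK | hL
        · rw [heK hK, hc2 t hK]
        · rw [heL hL, hd2 t hL]
      · rw [heK left_mem_uIcc, hcx]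
      · rw [heL right_mem_uIcc, hdz]
  intro x y hxy
  obtain ⟨c, -, -, hx, hy⟩ := hR x y
  rw [← hx, hxy, hy]

namespace ClosedSurface

variable {M : ClosedSurface}

/-! ### The profile curve -/

variable (M) in
/-- The profile curve: the part of the surface in the closed half plane `x₂ = 0`, `x₁ ≥ 0`. It
meets each orbit of the rotations in exactly one point. -/
def profile : Set E3 := {x | x ∈ M.carrier ∧ x 1 = 0 ∧ 0 ≤ x 0}

/-- The point of the half plane `x₂ = 0`, `x₁ ≥ 0` on the orbit of `x`. -/
def toProfile (x : E3) : E3 := !₂[Real.sqrt (axisDistSq x), 0, x 2]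

lemma axisDistSq_axisRotation (s : ℝ) (x : E3) : axisDistSq (axisRotation s x) = axisDistSq x := by
  simp only [axisDistSq, axisRotation_zero, axisRotation_one]
  linear_combination (x 0 ^ 2 + x 1 ^ 2) * Real.sin_sq_add_cos_sq s

lemma axisDistSq_nonneg (x : E3) : 0 ≤ axisDistSq x := by unfold axisDistSq; positivity

lemma exists_toProfile_eq (x : E3) : ∃ s, toProfile x = axisRotation s x := by
  obtain ⟨r, θ, hr, h0, h1⟩ : ∃ r θ : ℝ, Real.sqrt (axisDistSq x) = r ∧
      x 0 = r * Real.cos θ ∧ x 1 = r * Real.sin θ := by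
    let z : ℂ := ⟨x 0, x 1⟩
    refine ⟨‖z‖, z.arg, ?_, (Complex.norm_mul_cos_arg z).symm, (Complex.norm_mul_sin_arg z).symm⟩
    rw [Complex.norm_def, Complex.normSq_apply, axisDistSq]; congr 1; simp [z]; ring
  refine ⟨-θ, ?_⟩
  apply ext_E3
  · simp only [toProfile, axisRotation_zero, Real.cos_neg, Real.sin_neg, hr, h0, h1]
    simp
    linear_combination -r * Real.sin_sq_add_cos_sq θ
  · simp only [toProfile, axisRotation_one, Real.cos_neg, Real.sin_neg, h0, h1]
    simp; ring
  · simp [toProfile]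

lemma toProfile_eq_self {x : E3} (hx : x ∈ M.profile) : toProfile x = x := by
  apply ext_E3
  · simp [toProfile, axisDistSq, hx.2.1, Real.sqrt_sq hx.2.2]
  · simp [toProfile, hx.2.1]
  · simp [toProfile]

lemma toProfile_mem (hrot : M.IsRotationInvariant) {x : E3} (hx : x ∈ M.carrier) :
    toProfile x ∈ M.profile := by
  refine ⟨?_, by simp [toProfile], by simp [toProfile]⟩
  obtain ⟨s, hs⟩ := exists_toProfile_eq x
  exact hs ▸ hrot s x hx

lemma eq_toProfile {Y : Type*} {h : E3 → Y}
    (hinv : ∀ s, ∀ x ∈ M.carrier, h (axisRotation s x) = h x) {x : E3} (hx : x ∈ M.carrier) :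
    h x = h (toProfile x) := by
  obtain ⟨s, hs⟩ := exists_toProfile_eq x
  rw [hs, hinv s x hx]

lemma continuous_toProfile : Continuous toProfile := by
  unfold toProfile axisDistSq
  refine (PiLp.continuous_toLp 2 _).comp (continuous_pi fun i => ?_)
  fin_cases i <;> simp <;> fun_prop

lemma isPreconnected_profile (hrot : M.IsRotationInvariant) : IsPreconnected M.profile := by
  have : M.profile = toProfile '' M.carrier := by
    ext x
    constructor
    · exact fun hx => ⟨x, hx.1, toProfile_eq_self hx⟩
    · rintro ⟨y, hy, rfl⟩
      exact toProfile_mem hrot hy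
  rw [this]
  exact M.isConnected_frontier.isPreconnected.image _ continuous_toProfile.continuousOn

lemma hasFDerivAt_triple {a b c : E3 → ℝ} {a' b' c' : E3 →L[ℝ] ℝ} {x : E3}
    (ha : HasFDerivAt a a' x) (hb : HasFDerivAt b b' x) (hc : HasFDerivAt c c' x) :
    ∃ A : E3 →L[ℝ] E3, HasFDerivAt (fun y => (!₂[a y, b y, c y] : E3)) A x ∧
      ∀ v, A v = !₂[a' v, b' v, c' v] := by
  have h : HasFDerivAt (fun y => ![a y, b y, c y])
      (ContinuousLinearMap.pi ![a', b', c']) x := by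
    rw [hasFDerivAt_pi']
    intro i
    fin_cases i <;> simpa
  refine ⟨_, (EuclideanSpace.equiv (Fin 3) ℝ).symm.hasFDerivAt.comp x h, fun v => ?_⟩
  ext i
  fin_cases i <;> simp

lemma contDiff_triple {a b c : E3 → ℝ} (ha : ContDiff ℝ ∞ a) (hb : ContDiff ℝ ∞ b)
    (hc : ContDiff ℝ ∞ c) : ContDiff ℝ ∞ (fun y => (!₂[a y, b y, c y] : E3)) := by
  rw [contDiff_euclidean]
  intro i
  fin_cases i <;> simpa

lemma hasFDerivAt_coord (i : Fin 3) (x : E3) :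
    HasFDerivAt (fun y : E3 => y i) (EuclideanSpace.proj i : E3 →L[ℝ] ℝ) x :=
  (EuclideanSpace.proj i : E3 →L[ℝ] ℝ).hasFDerivAt

lemma contDiff_coord (i : Fin 3) : ContDiff ℝ ∞ (fun y : E3 => y i) :=
  (EuclideanSpace.proj i : E3 →L[ℝ] ℝ).contDiff

variable {ξ : E3 → ℝ}

/-- Off the axis, the profile curve is locally parametrized by the rotation potential. -/
lemma IsRotationPotential.exists_section (hrot : M.IsRotationInvariant)
    (hξ : M.IsRotationPotential ξ) {x : E3} (hx : x ∈ M.profile) (hx0 : 0 < x 0) :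
    ∃ ε > 0, ∃ U ∈ 𝓝 x, ∃ γ : ℝ → E3, ContDiffAt ℝ ∞ γ (ξ x) ∧
      ContinuousOn γ (Ioo (ξ x - ε) (ξ x + ε)) ∧
      (∀ y ∈ U, y ∈ M.profile → ξ y ∈ Ioo (ξ x - ε) (ξ x + ε) ∧ γ (ξ y) = y) ∧
      ∀ t ∈ Ioo (ξ x - ε) (ξ x + ε), γ t ∈ U ∧ γ t ∈ M.profile ∧ 0 < γ t 0 ∧ ξ (γ t) = t := by
  obtain ⟨g, hg⟩ := exists_isDefining hx.1
  obtain ⟨Ξ, hΞ, hξΞ⟩ := hξ.1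
  have hdg := (hg.1.differentiable (by simp) x).hasFDerivAt
  have hdΞ := (hΞ.differentiable (by simp) x).hasFDerivAt
  -- The functions `g`, `ξ` and `x₂` are coordinates at `x`, and the profile curve is the line in
  -- which `g` and `x₂` vanish.
  obtain ⟨A, hA, hAv⟩ := hasFDerivAt_triple hdg hdΞ (hasFDerivAt_coord 1 x)
  have hX : rotationField x = x 0 • (EuclideanSpace.single 1 1 : E3) := by
    apply ext_E3 <;> simp [hx.2.1]
  have hinj : ∀ v, A v = 0 → v = 0 := by
    intro v hv
    rw [hAv] at hv
    have h0 : fderiv ℝ g x v = 0 := by simpa using congrArg (fun w : E3 => w 0) hv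
    have h1 : fderiv ℝ Ξ x v = 0 := by simpa using congrArg (fun w : E3 => w 1) hv
    have h2 : v 1 = 0 := by simpa using congrArg (fun w : E3 => w 2) hv
    rw [fderiv_eq_inner_gradient, hg.gradient_eq hx.1, real_inner_smul_left] at h0
    have hnv := (mul_eq_zero.1 h0).resolve_left (norm_ne_zero_iff.2 hg.2.1)
    have hΞ' : HasFDerivWithinAt ξ (fderiv ℝ Ξ x) M.carrier x :=
      hdΞ.hasFDerivWithinAt.congr hξΞ (hξΞ hx.1)
    rw [← inner_surfaceGradient hx.1 hΞ' (mem_tangentPlane.2 hnv), hξ.surfaceGradient_eq hx.1,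
      J] at h1
    have h3 := expansion_of_orthogonal (inner_normal_self hx.1)
      (mem_tangentPlane.1 (hrot.rotationField_mem hx.1)) hnv
    rw [h1, zero_smul, add_zero, inner_rotationField_self] at h3
    have h4 : inner ℝ (rotationField x) v = (0 : ℝ) := by
      simp [inner_E3, h2, hx.2.1]
    rw [h4, zero_smul] at h3
    have h5 : axisDistSq x ≠ 0 := by simp [axisDistSq, hx.2.1, hx0.ne']
    exact (smul_eq_zero.1 h3.symm).resolve_left h5
  obtain ⟨e, he, hxe, hs, -⟩ := exists_chart
    (contDiff_triple hg.1 hΞ (contDiff_coord 1)) hA hinj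
  have hev : ∀ᶠ y in 𝓝 x, M.IsDefining g y ∧ 0 < y 0 :=
    hg.eventually.and ((contDiff_coord 0).continuous.continuousAt.tendsto.eventually_const_lt hx0)
  obtain ⟨V, hV, hVo, hxV⟩ := eventually_nhds_iff.1 hev
  let ℓ : ℝ → E3 := fun t => !₂[0, t, 0]
  have hℓ : ContDiff ℝ ∞ ℓ := by
    rw [contDiff_euclidean]; intro i; fin_cases i <;> simp [ℓ] <;> fun_prop
  have hex : e x = ℓ (ξ x) := by
    rw [he, hξΞ hx.1]; simp [ℓ, hg.eq_zero hx.1, hx.2.1]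
  have hopen : IsOpen (ℓ ⁻¹' (e.target ∩ e.symm ⁻¹' V)) :=
    (e.isOpen_inter_preimage_symm hVo).preimage hℓ.continuous
  obtain ⟨ε, hε, hball⟩ := Metric.isOpen_iff.1 hopen (ξ x) (by
    refine ⟨?_, ?_⟩
    · rw [← hex]; exact e.map_source hxe
    · simpa [← hex, e.left_inv hxe] using hxV)
  rw [Real.ball_eq_Ioo] at hball
  have hγ : ∀ t ∈ Ioo (ξ x - ε) (ξ x + ε), g (e.symm (ℓ t)) = 0 ∧ Ξ (e.symm (ℓ t)) = t ∧
      e.symm (ℓ t) 1 = 0 := by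
    intro t ht
    have h1 := e.right_inv (hball ht).1
    rw [he] at h1
    exact ⟨by simpa [ℓ] using congrArg (fun w : E3 => w 0) h1,
      by simpa [ℓ] using congrArg (fun w : E3 => w 1) h1,
      by simpa [ℓ] using congrArg (fun w : E3 => w 2) h1⟩
  have hγM : ∀ t ∈ Ioo (ξ x - ε) (ξ x + ε), e.symm (ℓ t) ∈ M.profile := fun t ht =>
    have hVt := hV _ (hball ht).2
    ⟨hVt.1.mem_carrier (hγ t ht).1, (hγ t ht).2.2, hVt.2.le⟩
  refine ⟨ε, hε, e.source ∩ V ∩ Ξ ⁻¹' Ioo (ξ x - ε) (ξ x + ε), ?_, fun t => e.symm (ℓ t), ?_, ?_,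
    ?_, ?_⟩
  · refine inter_mem (inter_mem (e.open_source.mem_nhds hxe) (hVo.mem_nhds hxV)) ?_
    refine hΞ.continuous.continuousAt.preimage_mem_nhds (Ioo_mem_nhds ?_ ?_) <;>
      rw [← hξΞ hx.1] <;> linarith
  · have hs' : ContDiffAt ℝ ∞ e.symm (ℓ (ξ x)) := by
      rw [← hex, he]; exact hs
    exact hs'.comp (ξ x) hℓ.contDiffAt
  · exact e.continuousOn_symm.comp hℓ.continuous.continuousOn fun t ht => (hball ht).1
  · rintro y ⟨⟨hys, hyV⟩, hyΞ⟩ hyP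
    refine ⟨by rw [hξΞ hyP.1]; exact hyΞ, ?_⟩
    have : e y = ℓ (ξ y) := by
      rw [he, hξΞ hyP.1]; simp [ℓ, (hV y hyV).1.eq_zero hyP.1, hyP.2.1]
    beta_reduce
    rw [← this, e.left_inv hys]
  · intro t ht
    have hVt := hV _ (hball ht).2
    refine ⟨⟨⟨e.map_target (hball ht).1, (hball ht).2⟩, ?_⟩, hγM t ht, hVt.2, ?_⟩
    · rw [mem_preimage, (hγ t ht).2.1]; exact ht
    · rw [hξΞ (hγM t ht).1, (hγ t ht).2.1]

/-- On the axis, the normal points along the axis. -/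
lemma IsRotationInvariant.normal_of_axis (hrot : M.IsRotationInvariant) {x : E3}
    (hx : x ∈ M.carrier) (h0 : x 0 = 0) (h1 : x 1 = 0) :
    M.normal x 0 = 0 ∧ M.normal x 1 = 0 := by
  have hfix : axisRotation Real.pi x = x := by apply ext_E3 <;> simp [h0, h1]
  have h := hrot.normal Real.pi hx
  rw [hfix] at h
  have e0 := congrArg (fun w : E3 => w 0) h
  have e1 := congrArg (fun w : E3 => w 1) h
  simp only [axisRotation_zero, axisRotation_one, Real.cos_pi, Real.sin_pi] at e0 e1
  constructor <;> linarith

/-- Near a point of the axis, where `∇ξ` vanishes, the rotation potential is still strictly monotone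
along the profile curve: the curve is parametrized by the distance to the axis, and the derivative
of `ξ` along it vanishes only on the axis. The profile curve ends at the axis, so `ξ` has a local
extremum there. -/
lemma IsRotationPotential.exists_section_of_axis (hrot : M.IsRotationInvariant)
    (hξ : M.IsRotationPotential ξ) {x : E3} (hx : x ∈ M.profile) (hx0 : x 0 = 0) :
    ∃ U ∈ 𝓝 x, ∃ γ : ℝ → E3, (∀ y ∈ U, y ∈ M.profile → γ (ξ y) = y) ∧
      ContinuousOn γ (ξ '' (U ∩ M.profile)) ∧ (ξ '' (U ∩ M.profile)).OrdConnected ∧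
      ((∀ y ∈ U, y ∈ M.profile → ξ x ≤ ξ y) ∨ (∀ y ∈ U, y ∈ M.profile → ξ y ≤ ξ x)) := by
  obtain ⟨g, hg⟩ := exists_isDefining hx.1
  obtain ⟨Ξ, hΞ, hξΞ⟩ := hξ.1
  have hdg := (hg.1.differentiable (by simp) x).hasFDerivAt
  -- The functions `x₁`, `x₂` and `g` are coordinates at `x`, because the normal is vertical.
  obtain ⟨A, hA, hAv⟩ := hasFDerivAt_triple (hasFDerivAt_coord 0 x) (hasFDerivAt_coord 1 x) hdg
  obtain ⟨hn0, hn1⟩ := hrot.normal_of_axis hx.1 hx0 hx.2.1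
  have hinj : ∀ v, A v = 0 → v = 0 := by
    intro v hv
    rw [hAv] at hv
    have h0 : v 0 = 0 := by simpa using congrArg (fun w : E3 => w 0) hv
    have h1 : v 1 = 0 := by simpa using congrArg (fun w : E3 => w 1) hv
    have h2 : fderiv ℝ g x v = 0 := by simpa using congrArg (fun w : E3 => w 2) hv
    rw [fderiv_eq_inner_gradient, hg.gradient_eq hx.1, real_inner_smul_left] at h2
    have hnv := (mul_eq_zero.1 h2).resolve_left (norm_ne_zero_iff.2 hg.2.1)
    have hnn := inner_normal_self hx.1
    rw [inner_E3, hn0, hn1] at hnv hnn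
    have hn2 : M.normal x 2 ≠ 0 := by
      intro h; rw [h] at hnn; simp at hnn
    refine ext_E3 h0 h1 ?_
    simpa [hn2] using hnv
  obtain ⟨e, he, hxe, hs, -⟩ := exists_chart
    (contDiff_triple (contDiff_coord 0) (contDiff_coord 1) hg.1) hA hinj
  let ℓ : ℝ → E3 := fun t => !₂[t, 0, 0]
  have hℓ : ContDiff ℝ ∞ ℓ := by
    rw [contDiff_euclidean]; intro i; fin_cases i <;> simp [ℓ] <;> fun_prop
  have hex : e x = ℓ 0 := by
    rw [he]; simp [ℓ, hg.eq_zero hx.1, hx.2.1, hx0]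
  have hs' : ∀ᶠ z in 𝓝 (ℓ 0), ContDiffAt ℝ 1 e.symm z := by
    rw [← hex, he]
    exact (hs.of_le (by simp)).eventually (by simp)
  obtain ⟨V, hV, hVo, hxV⟩ := eventually_nhds_iff.1 hg.eventually
  have hev : ∀ᶠ t in 𝓝 (0 : ℝ), ℓ t ∈ e.target ∩ e.symm ⁻¹' V ∧ ContDiffAt ℝ 1 e.symm (ℓ t) := by
    refine hℓ.continuous.continuousAt.tendsto.eventually (Filter.Eventually.and ?_ hs')
    refine (e.isOpen_inter_preimage_symm hVo).mem_nhds ⟨?_, ?_⟩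
    · rw [← hex]; exact e.map_source hxe
    · simpa [← hex, e.left_inv hxe] using hxV
  obtain ⟨ε, hε, hball⟩ := Metric.eventually_nhds_iff_ball.1 hev
  rw [Real.ball_eq_Ioo, zero_sub, zero_add] at hball
  let c : ℝ → E3 := fun t => e.symm (ℓ t)
  have hc : ∀ t ∈ Ioo (-ε) ε, c t 0 = t ∧ c t 1 = 0 ∧ g (c t) = 0 := by
    intro t ht
    have h1 := e.right_inv (hball t ht).1.1
    rw [he] at h1
    exact ⟨by simpa [ℓ, c] using congrArg (fun w : E3 => w 0) h1,
      by simpa [ℓ, c] using congrArg (fun w : E3 => w 1) h1,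
      by simpa [ℓ, c] using congrArg (fun w : E3 => w 2) h1⟩
  have hcD : ∀ t ∈ Ioo (-ε) ε, M.IsDefining g (c t) := fun t ht => hV _ (hball t ht).1.2
  have hcM : ∀ t ∈ Ioo (-ε) ε, c t ∈ M.carrier := fun t ht => (hcD t ht).mem_carrier (hc t ht).2.2
  have hcd : ∀ t ∈ Ioo (-ε) ε, HasDerivAt c (deriv c t) t := fun t ht =>
    (((hball t ht).2.comp t (hℓ.of_le (by simp)).contDiffAt).differentiableAt
      (by simp)).hasDerivAt
  -- The velocity of `c` is tangent and orthogonal to the rotation field, so it is not orthogonal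
  -- to `∇ξ` off the axis.
  have hcξ : ∀ t ∈ Ioo (-ε) ε, ∃ a, HasDerivAt (ξ ∘ c) a t ∧ (t ≠ 0 → a ≠ 0) := by
    intro t ht
    have hnear : ∀ᶠ s in 𝓝 t, s ∈ Ioo (-ε) ε := isOpen_Ioo.mem_nhds ht
    obtain ⟨A, hA⟩ := hξ.1.locallySmooth.exists_hasFDerivWithinAt (hcM t ht)
    refine ⟨A (deriv c t), hA.comp_hasDerivAt t (hcd t ht)
      (hnear.mono fun s hs => hcM s hs), fun ht0 hA0 => ht0 ?_⟩
    have hd0 : deriv c t 0 = 1 := by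
      have h1 := (hasFDerivAt_coord 0 (c t)).comp_hasDerivAt t (hcd t ht)
      have h2 : HasDerivAt ((fun y : E3 => y 0) ∘ c) 1 t :=
        (hasDerivAt_id t).congr_of_eventuallyEq (hnear.mono fun s hs => (hc s hs).1)
      simpa using h1.unique h2
    have hd1 : deriv c t 1 = 0 := by
      have h1 := (hasFDerivAt_coord 1 (c t)).comp_hasDerivAt t (hcd t ht)
      have h2 : HasDerivAt ((fun y : E3 => y 1) ∘ c) 0 t :=
        (hasDerivAt_const t (0 : ℝ)).congr_of_eventuallyEq (hnear.mono fun s hs => (hc s hs).2.1)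
      simpa using h1.unique h2
    have htan : inner ℝ (M.normal (c t)) (deriv c t) = (0 : ℝ) := by
      have h1 := ((hcD t ht).1.differentiable (by simp) (c t)).hasFDerivAt.comp_hasDerivAt t
        (hcd t ht)
      have h2 : HasDerivAt (g ∘ c) 0 t :=
        (hasDerivAt_const t (0 : ℝ)).congr_of_eventuallyEq (hnear.mono fun s hs => (hc s hs).2.2)
      have h3 := h1.unique h2
      rw [fderiv_eq_inner_gradient, (hcD t ht).gradient_eq (hcM t ht), real_inner_smul_left] at h3
      exact (mul_eq_zero.1 h3).resolve_left (norm_ne_zero_iff.2 (hcD t ht).2.1)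
    rw [← inner_surfaceGradient (hcM t ht) hA (mem_tangentPlane.2 htan),
      hξ.surfaceGradient_eq (hcM t ht), J] at hA0
    have h3 := expansion_of_orthogonal (inner_normal_self (hcM t ht))
      (mem_tangentPlane.1 (hrot.rotationField_mem (hcM t ht))) htan
    have h4 : inner ℝ (rotationField (c t)) (deriv c t) = (0 : ℝ) := by
      simp [inner_E3, hd1, (hc t ht).2.1]
    rw [hA0, h4, inner_rotationField_self] at h3
    have h5 := congrArg (fun w : E3 => w 0) h3
    simpa [hd0, axisDistSq, (hc t ht).1, (hc t ht).2.1] using h5.symm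
  have hIcc : Icc 0 (ε / 2) ⊆ Ioo (-ε) ε := fun t ht => ⟨by linarith [ht.1], by linarith [ht.2]⟩
  have hcont : ContinuousOn (ξ ∘ c) (Icc 0 (ε / 2)) := fun t ht =>
    let ⟨_, ha, _⟩ := hcξ t (hIcc ht)
    ha.continuousAt.continuousWithinAt
  have hinjOn : InjOn (ξ ∘ c) (Icc 0 (ε / 2)) := by
    have key : ∀ s ∈ Icc 0 (ε / 2), ∀ t ∈ Icc 0 (ε / 2), s < t → (ξ ∘ c) s ≠ (ξ ∘ c) t := by
      intro s hs t ht hst heq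
      obtain ⟨r, hr, hr0⟩ := exists_deriv_eq_zero hst
        (hcont.mono (Icc_subset_Icc hs.1 ht.2)) heq
      obtain ⟨a, ha, ha0⟩ := hcξ r (hIcc ⟨hs.1.trans hr.1.le, hr.2.le.trans ht.2⟩)
      rw [ha.deriv] at hr0
      exact ha0 (hs.1.trans_lt hr.1).ne' hr0
    intro s hs t ht heq
    rcases lt_trichotomy s t with h | h | h
    · exact absurd heq (key s hs t ht h)
    · exact h
    · exact absurd heq.symm (key t ht s hs h)
  have hmono := hcont.strictMonoOn_of_injOn_Icc' (by positivity) hinjOn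
  have hcx : c 0 = x := by simp [c, ← hex, e.left_inv hxe]
  let U : Set E3 := e.source ∩ V ∩ {y | y 0 < ε / 2}
  have hU : ∀ y ∈ U, y ∈ M.profile → y 0 ∈ Ico 0 (ε / 2) ∧ c (y 0) = y := by
    rintro y ⟨⟨hys, hyV⟩, hyε⟩ hyP
    refine ⟨⟨hyP.2.2, hyε⟩, ?_⟩
    have : e y = ℓ (y 0) := by
      rw [he]; simp [ℓ, (hV y hyV).eq_zero hyP.1, hyP.2.1]
    simp only [c]
    rw [← this, e.left_inv hys]
  have hU' : ∀ t ∈ Ico 0 (ε / 2), c t ∈ U ∩ M.profile := by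
    intro t ht
    have htI := hIcc ⟨ht.1, ht.2.le⟩
    refine ⟨⟨⟨e.map_target (hball t htI).1.1, (hball t htI).1.2⟩, ?_⟩, hcM t htI, (hc t htI).2.1, ?_⟩
    · simpa [(hc t htI).1] using ht.2
    · rw [(hc t htI).1]; exact ht.1
  have himage : ξ '' (U ∩ M.profile) = (ξ ∘ c) '' Ico 0 (ε / 2) := by
    ext s
    constructor
    · rintro ⟨y, ⟨hyU, hyP⟩, rfl⟩
      exact ⟨y 0, (hU y hyU hyP).1, by simp [(hU y hyU hyP).2]⟩
    · rintro ⟨t, ht, rfl⟩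
      exact ⟨c t, hU' t ht, rfl⟩
  have hinv : ∀ t ∈ Icc 0 (ε / 2), Function.invFunOn (ξ ∘ c) (Icc 0 (ε / 2)) ((ξ ∘ c) t) = t :=
    fun t ht => hinjOn.leftInvOn_invFunOn ht
  have hcc : ContinuousOn c (Icc 0 (ε / 2)) := fun t ht =>
    (hcd t (hIcc ht)).continuousAt.continuousWithinAt
  refine ⟨U, ?_, fun s => c (Function.invFunOn (ξ ∘ c) (Icc 0 (ε / 2)) s), ?_, ?_, ?_, ?_⟩
  · refine inter_mem (inter_mem (e.open_source.mem_nhds hxe) (hVo.mem_nhds hxV)) ?_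
    exact (contDiff_coord 0).continuous.continuousAt.tendsto.eventually_lt_const
      (by rw [hx0]; positivity)
  · intro y hyU hyP
    obtain ⟨h1, h2⟩ := hU y hyU hyP
    have h3 := hinv (y 0) ⟨h1.1, h1.2.le⟩
    simp only [Function.comp_apply, h2] at h3
    beta_reduce
    rw [h3, h2]
  · rw [himage]
    refine (hcc.comp (continuousOn_of_leftInverse isCompact_Icc hcont hinv) ?_).mono
      (image_mono Ico_subset_Icc_self)
    rintro _ ⟨t, ht, rfl⟩
    rw [hinv t ht]; exact ht
  · rw [himage]
    exact (isPreconnected_Ico.image _ (hcont.mono Ico_subset_Icc_self)).ordConnected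
  · refine hmono.imp (fun hm y hyU hyP => ?_) (fun hm y hyU hyP => ?_)
    all_goals
      obtain ⟨h1, h2⟩ := hU y hyU hyP
      have h0 : (0 : ℝ) ∈ Icc 0 (ε / 2) := ⟨le_rfl, by positivity⟩
    · have := hm.monotoneOn h0 ⟨h1.1, h1.2.le⟩ h1.1
      simpa [h2, hcx] using this
    · have := hm.antitoneOn h0 ⟨h1.1, h1.2.le⟩ h1.1
      simpa [h2, hcx] using this

/-- The rotation potential separates the orbits of the rotations. -/
theorem IsRotationPotential.injOn_profile (hrot : M.IsRotationInvariant)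
    (hξ : M.IsRotationPotential ξ) : InjOn ξ M.profile := by
  have key : ∀ x ∈ M.profile, ∃ U ∈ 𝓝 x, ∃ γ : ℝ → E3,
      (∀ y ∈ U, y ∈ M.profile → γ (ξ y) = y) ∧
      ContinuousOn γ (ξ '' (U ∩ M.profile)) ∧ (ξ '' (U ∩ M.profile)).OrdConnected := by
    intro x hx
    rcases hx.2.2.eq_or_lt with h0 | h0
    · obtain ⟨U, hU, γ, h1, h2, h3, -⟩ := hξ.exists_section_of_axis hrot hx h0.symm
      exact ⟨U, hU, γ, h1, h2, h3⟩
    · obtain ⟨ε, hε, U, hU, γ, -, h1, h2, h3⟩ := hξ.exists_section hrot hx h0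
      have : ξ '' (U ∩ M.profile) = Ioo (ξ x - ε) (ξ x + ε) := by
        ext t
        constructor
        · rintro ⟨y, hy, rfl⟩
          exact (h2 y hy.1 hy.2).1
        · exact fun ht => ⟨γ t, ⟨(h3 t ht).1, (h3 t ht).2.1⟩, (h3 t ht).2.2.2⟩
      exact ⟨U, hU, γ, fun y hy hyP => (h2 y hy hyP).2, by rwa [this], by
        rw [this]; exact ordConnected_Ioo⟩
  rw [injOn_iff_injective]
  have : PreconnectedSpace M.profile := Subtype.preconnectedSpace (isPreconnected_profile hrot)
  refine injective_of_local_sections fun x => ?_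
  obtain ⟨U, hU, γ, h1, h2, h3⟩ := key x x.2
  classical
  have himage : M.profile.domRestrict ξ '' (Subtype.val ⁻¹' U) = ξ '' (U ∩ M.profile) := by
    ext t
    constructor
    · rintro ⟨y, hy, rfl⟩
      exact ⟨y, ⟨hy, y.2⟩, rfl⟩
    · rintro ⟨y, hy, rfl⟩
      exact ⟨⟨y, hy.2⟩, hy.1, rfl⟩
  refine ⟨Subtype.val ⁻¹' U, continuous_subtype_val.continuousAt.preimage_mem_nhds hU,
    fun t => if h : γ t ∈ M.profile then ⟨γ t, h⟩ else x, ?_, ?_, ?_⟩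
  · intro y hy
    have := h1 y hy y.2
    have hm : γ (ξ y) ∈ M.profile := by rw [this]; exact y.2
    refine Subtype.ext ?_
    rw [domRestrict_apply]
    beta_reduce
    rw [dif_pos hm]
    exact this
  · rw [himage, Topology.IsInducing.subtypeVal.continuousOn_iff]
    refine h2.congr ?_
    rintro _ ⟨y, hy, rfl⟩
    have := h1 y hy.1 hy.2
    have hm : γ (ξ y) ∈ M.profile := by rw [this]; exact hy.2
    simp [dif_pos hm]
  · rwa [himage]

lemma IsRotationPotential.toProfile_eq (hrot : M.IsRotationInvariant)
    (hξ : M.IsRotationPotential ξ) {x y : E3} (hx : x ∈ M.carrier) (hy : y ∈ M.carrier)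
    (h : ξ x = ξ y) : toProfile x = toProfile y := by
  refine hξ.injOn_profile hrot (toProfile_mem hrot hx) (toProfile_mem hrot hy) ?_
  rw [← eq_toProfile (fun s z hz => hξ.isZonal.rotation_eq hrot s hz) hx,
    ← eq_toProfile (fun s z hz => hξ.isZonal.rotation_eq hrot s hz) hy, h]

/-- A point of the surface on the axis is a global extremum of the rotation potential. -/
lemma IsRotationPotential.extremum_of_axis (hrot : M.IsRotationInvariant)
    (hξ : M.IsRotationPotential ξ) {p : E3} (hp : p ∈ M.profile) (hp0 : p 0 = 0) :
    (∀ y ∈ M.profile, ξ p ≤ ξ y) ∨ (∀ y ∈ M.profile, ξ y ≤ ξ p) := by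
  obtain ⟨U, hU, -, -, -, -, hext⟩ := hξ.exists_section_of_axis hrot hp hp0
  have hinj := hξ.injOn_profile hrot
  have hcont : ContinuousOn ξ M.profile := hξ.1.locallySmooth.continuousOn.mono fun y hy => hy.1
  have key : ∀ ψ : E3 → ℝ, ContinuousOn ψ M.profile → InjOn ψ M.profile →
      (∀ y ∈ U, y ∈ M.profile → ψ p ≤ ψ y) → ∀ y ∈ M.profile, ψ p ≤ ψ y := by
    intro ψ hψ hψi hloc y hy
    -- The predicate `ψ p ≤ ψ z` is locally constant on the profile.
    have := (isPreconnected_profile hrot).induction₂ (fun a b => ψ p ≤ ψ a ↔ ψ p ≤ ψ b) ?_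
      (fun a b c _ _ _ h1 h2 => h1.trans h2) (fun a b _ _ h => h.symm) hp hy
    · exact this.1 le_rfl
    · intro a ha
      rcases lt_trichotomy (ψ p) (ψ a) with h | h | h
      · filter_upwards [(hψ a ha).tendsto.eventually_const_lt h] with b hb
        exact ⟨fun _ => hb.le, fun _ => h.le⟩
      · obtain rfl := hψi hp ha h
        filter_upwards [mem_nhdsWithin_of_mem_nhds hU, self_mem_nhdsWithin] with b hb hbP
        exact ⟨fun _ => hloc b hb hbP, fun _ => le_rfl⟩
      · filter_upwards [(hψ a ha).tendsto.eventually_lt_const h] with b hb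
        exact ⟨fun h' => absurd h' (not_le.2 h), fun h' => absurd h' (not_le.2 hb)⟩
  rcases hext with h | h
  · exact Or.inl (key ξ hcont hinj h)
  · refine Or.inr fun y hy => ?_
    have := key (fun y => -ξ y) hcont.neg (fun a ha b hb hab => hinj ha hb (neg_inj.1 hab))
      (fun y hyU hyP => neg_le_neg (h y hyU hyP)) y hy
    exact neg_le_neg_iff.1 this

variable {α₀ α₁ : ℝ}

/-! ### Invariant functions as functions of the rotation potential -/

lemma IsRotationPotential.mem_Ioo (hrot : M.IsRotationInvariant) (hξ : M.IsRotationPotential ξ)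
    (hα₀ : IsLeast (ξ '' M.carrier) α₀) (hα₁ : IsGreatest (ξ '' M.carrier) α₁) {x : E3}
    (hx : x ∈ M.carrier) (hx0 : axisDistSq x ≠ 0) : ξ x ∈ Ioo α₀ α₁ := by
  have hpos : 0 < toProfile x 0 := by
    simpa [toProfile] using lt_of_le_of_ne (axisDistSq_nonneg x) hx0.symm
  rw [eq_toProfile (fun s z hz => hξ.isZonal.rotation_eq hrot s hz) hx]
  obtain ⟨ε, hε, U, -, γ, -, -, -, h⟩ := hξ.exists_section hrot (toProfile_mem hrot hx) hpos
  set t := ξ (toProfile x)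
  have h1 := h (t - ε / 2) ⟨by linarith, by linarith⟩
  have h2 := h (t + ε / 2) ⟨by linarith, by linarith⟩
  have h3 := hα₀.2 ⟨_, h1.2.1.1, h1.2.2.2⟩
  have h4 := hα₁.2 ⟨_, h2.2.1.1, h2.2.2.2⟩
  constructor <;> linarith

/-- Values of the rotation potential in the open interval are attained off the axis, because the
points on the axis are global extrema. -/
lemma IsRotationPotential.exists_eq (hrot : M.IsRotationInvariant) (hξ : M.IsRotationPotential ξ)
    (hα₀ : IsLeast (ξ '' M.carrier) α₀) (hα₁ : IsGreatest (ξ '' M.carrier) α₁) {s : ℝ}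
    (hs : s ∈ Ioo α₀ α₁) : ∃ x ∈ M.profile, 0 < x 0 ∧ ξ x = s := by
  have hcon : (ξ '' M.carrier).OrdConnected :=
    (M.isConnected_frontier.isPreconnected.image _ hξ.1.locallySmooth.continuousOn).ordConnected
  have hz : ∀ {x : E3}, x ∈ M.carrier → ξ x = ξ (toProfile x) := fun hx =>
    eq_toProfile (fun s z hz => hξ.isZonal.rotation_eq hrot s hz) hx
  obtain ⟨y, hy, rfl⟩ := hcon.out hα₀.1 hα₁.1 ⟨hs.1.le, hs.2.le⟩
  have hP := toProfile_mem hrot hy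
  rw [hz hy] at hs ⊢
  refine ⟨toProfile y, hP, lt_of_le_of_ne hP.2.2 fun h0 => ?_, rfl⟩
  obtain ⟨a, ha, ha'⟩ := hα₀.1
  obtain ⟨b, hb, hb'⟩ := hα₁.1
  rw [hz ha] at ha'
  rw [hz hb] at hb'
  rcases hξ.extremum_of_axis hrot hP h0.symm with h | h
  · have := h _ (toProfile_mem hrot ha)
    linarith [hs.1]
  · have := h _ (toProfile_mem hrot hb)
    linarith [hs.2]

/-- Rotation-invariant functions are functions of the rotation potential, smooth away from its
extremal values. -/
lemma IsRotationPotential.exists_factorization (hrot : M.IsRotationInvariant)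
    (hξ : M.IsRotationPotential ξ) (hα₀ : IsLeast (ξ '' M.carrier) α₀)
    (hα₁ : IsGreatest (ξ '' M.carrier) α₁) {h : E3 → ℝ} (hh : M.LocallySmooth h)
    (hinv : ∀ s, ∀ x ∈ M.carrier, h (axisRotation s x) = h x) :
    ∃ F : ℝ → ℝ, ContDiffOn ℝ ∞ F (Ioo α₀ α₁) ∧ ∀ x ∈ M.carrier, h x = F (ξ x) := by
  classical
  -- The value `0` off the range of `ξ` is never used: `(α₀, α₁)` lies in the range.
  let F : ℝ → ℝ := fun t => if ht : ∃ x ∈ M.carrier, ξ x = t then h ht.choose else 0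
  have hF : ∀ x ∈ M.carrier, h x = F (ξ x) := by
    intro x hx
    have hex : ∃ y ∈ M.carrier, ξ y = ξ x := ⟨x, hx, rfl⟩
    simp only [F, dif_pos hex]
    rw [eq_toProfile hinv hx, eq_toProfile hinv hex.choose_spec.1,
      hξ.toProfile_eq hrot hex.choose_spec.1 hx hex.choose_spec.2]
  refine ⟨F, fun s hs => ContDiffAt.contDiffWithinAt ?_, hF⟩
  obtain ⟨x, hx, hx0, rfl⟩ := hξ.exists_eq hrot hα₀ hα₁ hs
  obtain ⟨ε, hε, U, hU, γ, hγ, -, h1, h2⟩ := hξ.exists_section hrot hx hx0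
  obtain ⟨H, hH⟩ := hh x hx.1
  have hmem : ∀ᶠ t in 𝓝 (ξ x), t ∈ Ioo (ξ x - ε) (ξ x + ε) :=
    Ioo_mem_nhds (by linarith) (by linarith)
  have hγx : γ (ξ x) = x := (h1 x (mem_of_mem_nhds hU) hx).2
  have hγt : Tendsto γ (𝓝 (ξ x)) (𝓝 x) := by simpa [hγx] using hγ.continuousAt.tendsto
  have hHx : ContDiffAt ℝ ∞ H (γ (ξ x)) := by rw [hγx]; exact hH.self_of_nhds.1
  refine (hHx.comp (ξ x) hγ).congr_of_eventuallyEq ?_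
  filter_upwards [hmem, hγt.eventually hH] with t ht hHt
  have h3 := h2 t ht
  have h4 := hF _ h3.2.1.1
  rw [h3.2.2.2] at h4
  rw [← h4, hHt.2 h3.2.1.1]
  rfl

lemma surfaceGradient_comp {h : E3 → ℝ} {F : ℝ → ℝ} (hξ : M.IsRotationPotential ξ)
    (hF : ∀ x ∈ M.carrier, h x = F (ξ x)) {x : E3} (hx : x ∈ M.carrier)
    (hd : DifferentiableAt ℝ F (ξ x)) :
    M.surfaceGradient h x = deriv F (ξ x) • M.surfaceGradient ξ x := by
  obtain ⟨A, hA⟩ := hξ.1.locallySmooth.exists_hasFDerivWithinAt hx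
  have h1 : HasFDerivWithinAt h (deriv F (ξ x) • A) M.carrier x :=
    (hd.hasDerivAt.comp_hasFDerivWithinAt x hA).congr hF (hF x hx)
  refine eq_of_inner_tangent (surfaceGradient_mem _ _)
    (Submodule.smul_mem _ _ (surfaceGradient_mem _ _)) fun v hv => ?_
  rw [inner_surfaceGradient hx h1 hv, real_inner_smul_left, inner_surfaceGradient hx hA hv]
  rfl

/-- The surface meets the axis only where the rotation potential attains its minimum or its
maximum over the profile curve. -/
lemma IsRotationPotential.finite_axis (hrot : M.IsRotationInvariant)
    (hξ : M.IsRotationPotential ξ) : {x ∈ M.carrier | axisDistSq x = 0}.Finite := by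
  have hsub : {x ∈ M.carrier | axisDistSq x = 0} ⊆ M.profile ∩ {x | x 0 = 0} := by
    rintro x ⟨hx, h0⟩
    have h1 : x 0 = 0 := by unfold axisDistSq at h0; nlinarith [sq_nonneg (x 0), sq_nonneg (x 1)]
    have h2 : x 1 = 0 := by unfold axisDistSq at h0; nlinarith [sq_nonneg (x 0), sq_nonneg (x 1)]
    exact ⟨⟨hx, h2, h1.ge⟩, h1⟩
  refine Finite.subset ?_ hsub
  have hinj := hξ.injOn_profile hrot
  have hmin : {x | x ∈ M.profile ∧ ∀ y ∈ M.profile, ξ x ≤ ξ y}.Subsingleton :=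
    fun a ha b hb => hinj ha.1 hb.1 (le_antisymm (ha.2 b hb.1) (hb.2 a ha.1))
  have hmax : {x | x ∈ M.profile ∧ ∀ y ∈ M.profile, ξ y ≤ ξ x}.Subsingleton :=
    fun a ha b hb => hinj ha.1 hb.1 (le_antisymm (hb.2 a ha.1) (ha.2 b hb.1))
  refine (hmin.finite.union hmax.finite).subset fun x hx => ?_
  exact (hξ.extremum_of_axis hrot hx.1 hx.2).imp (fun h => ⟨hx.1, h⟩) fun h => ⟨hx.1, h⟩

/-! ### The area measure -/

lemma measurableSet_carrier : MeasurableSet M.carrier := M.isClosed_carrier.measurableSet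

lemma measurePreserving_axisRotation (hrot : M.IsRotationInvariant) (s : ℝ) :
    MeasurePreserving (axisRotation s) M.area M.area := by
  have h := ((rotationEquiv s).toIsometryEquiv.measurePreserving_euclideanHausdorffMeasure
    2).restrict_preimage (measurableSet_carrier (M := M))
  have hpre : (rotationEquiv s).toIsometryEquiv ⁻¹' M.carrier = M.carrier := by
    ext x; exact hrot.mem_iff s x
  rw [hpre] at h
  exact h

lemma area_eq_zero_of_finite {S : Set E3} (hS : S.Finite) : M.area S = 0 := by
  refine Measure.absolutelyContinuous_of_le Measure.restrict_le_self ?_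
  rw [Measure.euclideanHausdorffMeasure_def]
  have : NullSingletonClass (Measure.hausdorffMeasure (2 : ℕ) : Measure E3) :=
    Measure.nullSingletonClass_hausdorff _ (by norm_num)
  rw [Measure.smul_apply, hS.measure_zero, smul_zero]

lemma ae_mem_carrier : ∀ᵐ x ∂M.area, x ∈ M.carrier := ae_restrict_mem measurableSet_carrier

lemma IsRotationPotential.ae_axisDistSq_ne (hrot : M.IsRotationInvariant)
    (hξ : M.IsRotationPotential ξ) : ∀ᵐ x ∂M.area, axisDistSq x ≠ 0 := by
  have h := area_eq_zero_of_finite (M := M) (hξ.finite_axis hrot)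
  filter_upwards [ae_mem_carrier (M := M), measure_eq_zero_iff_ae_notMem.1 h] with x hx hx' h0
  exact hx' ⟨hx, h0⟩

/-- The area is finite: locally the surface is a Lipschitz image of a disc. -/
instance : IsFiniteMeasure M.area := by
  constructor
  rw [area, Measure.restrict_apply_univ]
  refine M.isCompact_carrier.measure_lt_top_of_nhdsWithin fun x hx => ?_
  obtain ⟨g, hg⟩ := exists_isDefining hx
  obtain ⟨e, hxe, he, hex, hs, -⟩ := hg.exists_flattening hx
  obtain ⟨K, t, ht, hK⟩ := (hs.of_le (m := 1) (by simp)).exists_lipschitzOnWith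
  set n := M.normal x with hn
  set T := M.tangentPlane x with hT
  have hfin : Module.finrank ℝ T = 2 := by
    have h0 : n ≠ 0 := by
      intro h0
      have := norm_normal hx
      rw [← hn, h0, norm_zero] at this
      exact zero_ne_one this
    have : Fact (Module.finrank ℝ E3 = 2 + 1) := ⟨by simp⟩
    exact Submodule.finrank_orthogonal_span_singleton h0
  obtain ⟨r, hr, hball⟩ := Metric.mem_nhds_iff.1 ht
  let S : Set E3 := (fun v : T => e.symm v) '' Metric.ball (0 : T) r
  refine ⟨S, ?_, ?_⟩
  · have hnear : ∀ᶠ y in 𝓝 x, y ∈ e.source ∧ e y ∈ Metric.ball (0 : E3) r ∧ M.IsDefining g y := by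
      refine Filter.Eventually.and (e.open_source.mem_nhds hxe)
        (Filter.Eventually.and ?_ hg.eventually)
      have := e.continuousAt hxe
      rw [ContinuousAt, hex] at this
      exact this (Metric.ball_mem_nhds 0 hr)
    filter_upwards [mem_nhdsWithin_of_mem_nhds hnear, self_mem_nhdsWithin] with y hy hyM
    have htan : e y ∈ T := by
      rw [hT, mem_tangentPlane, ← hn, he, hy.2.2.eq_zero hyM, inner_add_right,
        real_inner_smul_right, inner_normal_self hx]
      ring
    exact ⟨⟨e y, htan⟩, by simpa using hy.2.1, e.left_inv hy.1⟩
  · have hL : LipschitzOnWith K (fun v : T => e.symm v) (Metric.ball (0 : T) r) := by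
      intro a ha b hb
      exact hK (hball (by simpa using ha)) (hball (by simpa using hb))
    have hb : (Measure.hausdorffMeasure (2 : ℕ) : Measure T) (Metric.ball 0 r) < ⊤ := by
      rw [← hfin]
      exact measure_ball_lt_top
    have h1 := hL.hausdorffMeasure_image_le (d := ((2 : ℕ) : ℝ)) (by positivity)
    have h2 : (Measure.hausdorffMeasure (2 : ℕ) : Measure E3) S < ⊤ :=
      h1.trans_lt (ENNReal.mul_lt_top (ENNReal.rpow_lt_top_of_nonneg (by positivity) (by simp)) hb)
    rw [Measure.euclideanHausdorffMeasure_def, Measure.smul_apply, ENNReal.smul_def, smul_eq_mul]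
    exact ENNReal.mul_lt_top ENNReal.coe_lt_top h2

end ClosedSurface

/-! ### Angular Fourier modes -/

/-- The normalized Lebesgue measure on a period of the rotation angle. -/
def angleMeasure : Measure ℝ :=
  ENNReal.ofReal (2 * Real.pi)⁻¹ • volume.restrict (Ioc 0 (2 * Real.pi))

instance : IsProbabilityMeasure angleMeasure := by
  constructor
  rw [angleMeasure, Measure.smul_apply, Measure.restrict_apply_univ, Real.volume_Ioc, sub_zero,
    smul_eq_mul, ← ENNReal.ofReal_mul (by positivity), inv_mul_cancel₀ (by positivity),
    ENNReal.ofReal_one]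

lemma integral_angleMeasure (f : ℝ → ℂ) :
    ∫ s, f s ∂angleMeasure = (2 * Real.pi)⁻¹ • ∫ s in (0 : ℝ)..2 * Real.pi, f s := by
  rw [angleMeasure, integral_smul_measure, intervalIntegral.integral_of_le (by positivity),
    ENNReal.toReal_ofReal (by positivity)]

/-- The character `e^{iks}` of the circle group. -/
def character (k : ℤ) (s : ℝ) : ℂ := Complex.exp (k * s * Complex.I)

lemma norm_character (k : ℤ) (s : ℝ) : ‖character k s‖ = 1 := by
  have := Complex.norm_exp_ofReal_mul_I (k * s)
  simpa [character] using this

lemma continuous_character (k : ℤ) : Continuous (character k) := by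
  unfold character; fun_prop

lemma character_add (k : ℤ) (s t : ℝ) : character k (s + t) = character k s * character k t := by
  rw [character, character, character, ← Complex.exp_add]; congr 1; push_cast; ring

lemma character_neg (k : ℤ) (s : ℝ) : character k (-s) = (starRingEnd ℂ) (character k s) := by
  rw [character, character, ← Complex.exp_conj]; congr 1; simp

lemma character_mul_neg (k : ℤ) (s : ℝ) : character k s * character k (-s) = 1 := by
  rw [← character_add]; simp [character]

lemma character_two_pi (k : ℤ) : character k (2 * Real.pi) = 1 := by
  rw [character, Complex.exp_eq_one_iff]
  exact ⟨k, by push_cast; ring⟩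

/-- The component of `u` on which the rotation by the angle `s` acts as multiplication by
`e^{iks}`. -/
def mode (k : ℤ) (u : E3 → ℂ) (x : E3) : ℂ :=
  ∫ s, character k (-s) * u (axisRotation s x) ∂angleMeasure

lemma mode_axisRotation (k : ℤ) (u : E3 → ℂ) (t : ℝ) (x : E3) :
    mode k u (axisRotation t x) = character k t * mode k u x := by
  have hper : Function.Periodic (fun s => character k (-s) * u (axisRotation s x))
      (2 * Real.pi) := by
    intro s
    simp only [neg_add, character_add, axisRotation_add_two_pi, character_neg k (2 * Real.pi),
      character_two_pi]
    simp
  have h1 : ∀ s, character k (-s) * u (axisRotation s (axisRotation t x)) =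
      character k t * (character k (-(s + t)) * u (axisRotation (s + t) x)) := by
    intro s
    rw [axisRotation_add, neg_add, character_add]
    linear_combination (-character k (-s) * u (axisRotation s (axisRotation t x))) *
      character_mul_neg k t
  rw [mode, mode, integral_angleMeasure, integral_angleMeasure]
  simp_rw [h1]
  rw [intervalIntegral.integral_const_mul, mul_smul_comm]
  congr 2
  rw [intervalIntegral.integral_comp_add_right
    (fun s => character k (-s) * u (axisRotation s x)), zero_add, add_comm (2 * Real.pi) t,
    hper.intervalIntegral_add_eq t 0, zero_add]

variable {μ : Measure E3}

/-- The rotations preserve the measure `μ`. -/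
def RotationPreserving (μ : Measure E3) : Prop :=
  ∀ s, MeasurePreserving (axisRotation s) μ μ

lemma RotationPreserving.integral_comp (hμ : RotationPreserving μ) (s : ℝ) (f : E3 → ℂ) :
    ∫ x, f (axisRotation s x) ∂μ = ∫ x, f x ∂μ :=
  (hμ s).integral_comp
    (rotationEquiv s).toHomeomorph.measurableEmbedding f

lemma memLp_conj {u : E3 → ℂ} (hu : MemLp u 2 μ) :
    MemLp (fun x => (starRingEnd ℂ) (u x)) 2 μ := hu.star

lemma ae_eq_zero_of_integral_mul_eq_zero {u : E3 → ℂ} (hu : Integrable u μ)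
    (h : ∀ φ : E3 → ℝ, ContDiff ℝ ∞ φ → HasCompactSupport φ → ∫ x, u x * φ x ∂μ = 0) :
    u =ᵐ[μ] 0 := by
  refine ae_eq_zero_of_integral_contDiff_smul_eq_zero hu.locallyIntegrable fun φ hφ hφc => ?_
  rw [← h φ hφ hφc]
  congr 1; ext x
  rw [Complex.real_smul, mul_comm]

section FiniteMeasure

variable [IsFiniteMeasure μ]

lemma RotationPreserving.memLp_prod (hμ : RotationPreserving μ) {u : E3 → ℂ}
    (hu : MemLp u 2 μ) :
    MemLp (fun p : ℝ × E3 => u (axisRotation p.1 p.2)) 2 (angleMeasure.prod μ) := by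
  have h : MeasurePreserving (fun p : ℝ × E3 => (p.1, axisRotation p.1 p.2))
      (angleMeasure.prod μ) (angleMeasure.prod μ) :=
    (MeasurePreserving.id angleMeasure).skew_product (g := axisRotation)
      continuous_rotation.measurable (Eventually.of_forall fun s => (hμ s).map_eq)
  exact (hu.comp_snd angleMeasure).comp_measurePreserving h

lemma memLp_character (k : ℤ) {α : Type*} [MeasurableSpace α] {ν : Measure α} {f : α → ℝ}
    (hf : Measurable f) {u : α → ℂ} (hu : MemLp u 2 ν) :
    MemLp (fun p => character k (f p) * u p) 2 ν := by
  refine hu.of_le ?_ (Eventually.of_forall fun p => ?_)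
  · exact ((continuous_character k).measurable.comp hf).aestronglyMeasurable.mul
      hu.aestronglyMeasurable
  · rw [norm_mul, norm_character, one_mul]

/-- Jensen's inequality for the square. -/
lemma sq_integral_le {ν : Measure ℝ} [IsProbabilityMeasure ν] {f : ℝ → ℂ} (hf : MemLp f 2 ν) :
    ‖∫ s, f s ∂ν‖ ^ 2 ≤ ∫ s, ‖f s‖ ^ 2 ∂ν := by
  have h1 : Integrable (fun s => ‖f s‖) ν := (hf.integrable (by norm_num)).norm
  have h2 : Integrable (fun s => ‖f s‖ ^ 2) ν := hf.integrable_norm_pow (by norm_num)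
  set m := ∫ s, ‖f s‖ ∂ν with hm
  have h3 : 0 ≤ ∫ s, (‖f s‖ - m) ^ 2 ∂ν := integral_nonneg fun s => sq_nonneg _
  have h4 : ∫ s, (‖f s‖ - m) ^ 2 ∂ν = ∫ s, ‖f s‖ ^ 2 ∂ν - 2 * m * m + m ^ 2 := by
    have : ∀ s, (‖f s‖ - m) ^ 2 = ‖f s‖ ^ 2 - 2 * m * ‖f s‖ + m ^ 2 := fun s => by ring
    simp_rw [this]
    rw [integral_add (f := fun s => ‖f s‖ ^ 2 - 2 * m * ‖f s‖) (h2.sub (h1.const_mul _))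
      (integrable_const _), integral_sub h2 (h1.const_mul _), integral_const_mul, ← hm]
    simp
  have h5 : ‖∫ s, f s ∂ν‖ ≤ m := norm_integral_le_integral_norm f
  nlinarith [norm_nonneg (∫ s, f s ∂ν)]

lemma RotationPreserving.memLp_mode (hμ : RotationPreserving μ) (k : ℤ) {u : E3 → ℂ}
    (hu : MemLp u 2 μ) : MemLp (mode k u) 2 μ := by
  have h1 := memLp_character k (f := fun p : ℝ × E3 => -p.1) (by fun_prop) (hμ.memLp_prod hu)
  have h2 := h1.integrable_norm_pow (by norm_num)
  have hm : AEStronglyMeasurable (mode k u) μ :=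
    h1.aestronglyMeasurable.prod_swap.integral_prod_right'
  rw [memLp_two_iff_integrable_sq_norm hm]
  refine h2.integral_prod_right.mono (hm.norm.pow 2) ?_
  filter_upwards [h2.prod_left_ae, (h1.integrable (by norm_num)).prod_left_ae] with x hx hx'
  rw [Real.norm_of_nonneg (by positivity),
    Real.norm_of_nonneg (integral_nonneg fun s => by positivity)]
  exact sq_integral_le ((memLp_two_iff_integrable_sq_norm hx'.aestronglyMeasurable).2 hx)

/-- The correlations of square integrable functions along the rotations are integrable. -/
lemma RotationPreserving.integrable_pairing (hμ : RotationPreserving μ) (k : ℤ) {u v : E3 → ℂ}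
    (hu : MemLp u 2 μ) (hv : MemLp v 2 μ) :
    Integrable (fun s => character k (-s) * ∫ x, u (axisRotation s x) * v x ∂μ) angleMeasure := by
  have h1 := memLp_character k (f := fun p : ℝ × E3 => -p.1) (by fun_prop) (hμ.memLp_prod hu)
  refine (h1.integrable_mul (hv.comp_snd angleMeasure)).integral_prod_left.congr
    (Eventually.of_forall fun s => ?_)
  simp only [Pi.mul_apply]
  rw [← integral_const_mul]
  congr 1; ext x; ring

/-- The pairing with a mode is a Fourier coefficient of the correlation along the rotations. -/
lemma RotationPreserving.integral_mode_mul (hμ : RotationPreserving μ) (k : ℤ) {u v : E3 → ℂ}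
    (hu : MemLp u 2 μ) (hv : MemLp v 2 μ) :
    ∫ x, mode k u x * v x ∂μ =
      ∫ s, character k (-s) * ∫ x, u (axisRotation s x) * v x ∂μ ∂angleMeasure := by
  have h1 := memLp_character k (f := fun p : ℝ × E3 => -p.1) (by fun_prop) (hμ.memLp_prod hu)
  have h2 := h1.integrable_mul (hv.comp_snd angleMeasure)
  have h3 := integral_integral_swap
    (f := fun s x => character k (-s) * u (axisRotation s x) * v x) h2
  calc ∫ x, mode k u x * v x ∂μ
      = ∫ x, ∫ s, character k (-s) * u (axisRotation s x) * v x ∂angleMeasure ∂μ := by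
        congr 1; ext x
        rw [mode, ← integral_mul_const]
    _ = ∫ s, ∫ x, character k (-s) * u (axisRotation s x) * v x ∂μ ∂angleMeasure := h3.symm
    _ = _ := by
        congr 1; ext s
        rw [← integral_const_mul]
        congr 1; ext x; ring

/-- The map `mode k` is an orthogonal projection of `L²`. -/
lemma RotationPreserving.integral_mode_mul_conj_aux (hμ : RotationPreserving μ) (k : ℤ)
    {u v : E3 → ℂ} (hu : MemLp u 2 μ) (hv : MemLp v 2 μ) :
    ∫ x, mode k u x * (starRingEnd ℂ) (mode k v x) ∂μ =
      ∫ x, u x * (starRingEnd ℂ) (mode k v x) ∂μ := by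
  rw [hμ.integral_mode_mul k hu (memLp_conj (hμ.memLp_mode k hv))]
  have : ∀ s, character k (-s) * ∫ x, u (axisRotation s x) * (starRingEnd ℂ) (mode k v x) ∂μ =
      ∫ x, u x * (starRingEnd ℂ) (mode k v x) ∂μ := by
    intro s
    rw [← integral_const_mul,
      ← hμ.integral_comp s (fun x => u x * (starRingEnd ℂ) (mode k v x))]
    congr 1; ext x
    rw [mode_axisRotation, map_mul, ← character_neg]
    ring
  simp_rw [this]
  simp

/-- The `k`-th mode of the sesquilinear pairing of `L²`. -/
lemma RotationPreserving.integral_mode_mul_conj (hμ : RotationPreserving μ) (k : ℤ)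
    {u v : E3 → ℂ} (hu : MemLp u 2 μ) (hv : MemLp v 2 μ) :
    ∫ x, mode k u x * (starRingEnd ℂ) (mode k v x) ∂μ =
      ∫ s, character k (-s) * ∫ x, u (axisRotation s x) * (starRingEnd ℂ) (v x) ∂μ
        ∂angleMeasure := by
  rw [← hμ.integral_mode_mul k hu (memLp_conj hv)]
  have h := congrArg (starRingEnd ℂ) (hμ.integral_mode_mul_conj_aux k hv hu)
  rw [← integral_conj, ← integral_conj] at h
  simp only [map_mul, Complex.conj_conj] at h
  simpa only [mul_comm] using h

/-- A square integrable function all of whose modes vanish is orthogonal to all continuous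
functions of compact support. -/
lemma RotationPreserving.integral_eq_zero_of_mode (hμ : RotationPreserving μ) {u : E3 → ℂ}
    (hu : MemLp u 2 μ) (hmode : ∀ k, mode k u =ᵐ[μ] 0) {φ : E3 → ℝ} (hφ : Continuous φ)
    (hφc : HasCompactSupport φ) : ∫ x, u x * φ x ∂μ = 0 := by
  obtain ⟨C, hC⟩ := hφc.exists_bound_of_continuous hφ
  have hφL : MemLp (fun x => (φ x : ℂ)) 2 μ :=
    MemLp.of_bound (by fun_prop : Continuous fun x => (φ x : ℂ)).aestronglyMeasurable C
      (Eventually.of_forall fun x => by simpa using hC x)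
  -- A continuous periodic function of the angle; its Fourier coefficients are pairings of `φ` with
  -- the modes of `u`, and the value to compute is `A 0`.
  let A : ℝ → ℂ := fun s => ∫ x, u (axisRotation s x) * φ x ∂μ
  have hA' : A = fun s => ∫ x, u x * φ (axisRotation (-s) x) ∂μ := by
    ext s
    rw [← hμ.integral_comp s (fun x => u x * φ (axisRotation (-s) x))]
    simp [A]
  have hcont : Continuous A := by
    rw [hA']
    refine continuous_of_dominated (bound := fun x => ‖u x‖ * C) (fun s => ?_) (fun s => ?_) ?_ ?_
    · have : Continuous fun x => (φ (axisRotation (-s) x) : ℂ) := by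
        have := (contDiff_axisRotation (-s)).continuous
        fun_prop
      exact hu.aestronglyMeasurable.mul this.aestronglyMeasurable
    · refine Eventually.of_forall fun x => ?_
      rw [norm_mul]
      gcongr
      simpa using hC _
    · exact (hu.integrable (by norm_num)).norm.mul_const C
    · refine Eventually.of_forall fun x => ?_
      have hc : Continuous fun s : ℝ => axisRotation s x :=
        continuous_iff_continuousAt.2 fun t => (hasDerivAt_axisRotation t x).continuousAt
      have hc' : Continuous fun s : ℝ => axisRotation (-s) x := hc.comp continuous_neg
      fun_prop
  have hper : Function.Periodic A (2 * Real.pi) := by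
    intro s; simp only [A, axisRotation_add_two_pi]
  have : Fact (0 < 2 * Real.pi) := ⟨by positivity⟩
  let Ã : C(AddCircle (2 * Real.pi), ℂ) := ⟨hper.lift, hcont.quotient_lift _⟩
  have hcoef : ∀ k, fourierCoeff Ã k = 0 := by
    intro k
    have h1 : ∫ s, character k (-s) * A s ∂angleMeasure = 0 := by
      rw [← hμ.integral_mode_mul k hu hφL]
      refine integral_eq_zero_of_ae ?_
      filter_upwards [hmode k] with x hx
      simp [hx]
    rw [fourierCoeff_eq_intervalIntegral _ k 0, zero_add]
    rw [integral_angleMeasure] at h1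
    rw [one_div, ← h1]
    congr 2; ext s
    have h2 : (fourier (-k)) (s : AddCircle (2 * Real.pi)) = character k (-s) := by
      rw [fourier_coe_apply, character]
      congr 1
      push_cast
      field_simp
    rw [h2]
    rfl
  have hsum := has_pointwise_sum_fourier_series_of_summable (f := Ã)
    (by rw [funext hcoef]; exact summable_zero) ((0 : ℝ) : AddCircle (2 * Real.pi))
  simp only [hcoef, zero_smul] at hsum
  have h0 : Ã ((0 : ℝ) : AddCircle (2 * Real.pi)) = A 0 := rfl
  rw [h0] at hsum
  have := hsum.unique hasSum_zero
  simpa [A] using this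

/-- A nonzero square integrable function has a nonzero mode. -/
theorem RotationPreserving.exists_mode_ne_zero (hμ : RotationPreserving μ) {u : E3 → ℂ}
    (hu : MemLp u 2 μ) (hne : ¬ u =ᵐ[μ] 0) : ∃ k, ¬ mode k u =ᵐ[μ] 0 := by
  by_contra! hcon
  exact hne (ae_eq_zero_of_integral_mul_eq_zero (hu.integrable (by norm_num)) fun φ hφ hφc =>
    hμ.integral_eq_zero_of_mode hu hcon hφ.continuous hφc)

end FiniteMeasure

/-- The derivative of `φ` along the rotation field. -/
def rotationDeriv (φ : E3 → ℝ) (x : E3) : ℝ := fderiv ℝ φ x (rotationField x)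

lemma hasDerivAt_comp_rotation {φ : E3 → ℝ} (hφ : ContDiff ℝ ∞ φ) (s : ℝ) (x : E3) :
    HasDerivAt (fun t => φ (axisRotation t x)) (rotationDeriv φ (axisRotation s x)) s :=
  (hφ.differentiable (by simp) _).hasFDerivAt.comp_hasDerivAt s (hasDerivAt_axisRotation s x)

lemma continuous_rotationDeriv {φ : E3 → ℝ} (hφ : ContDiff ℝ ∞ φ) :
    Continuous (rotationDeriv φ) :=
  (hφ.continuous_fderiv (by simp)).clm_apply contDiff_rotationField.continuous

lemma hasCompactSupport_rotationDeriv {φ : E3 → ℝ} (hφc : HasCompactSupport φ) :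
    HasCompactSupport (rotationDeriv φ) :=
  (hφc.fderiv ℝ).mono' fun x hx => by
    refine subset_tsupport _ fun h0 => hx ?_
    simp [rotationDeriv, h0]

/-- In the `k`-th mode, the rotation field acts in the sense of distributions as multiplication
by `ik`. -/
lemma RotationPreserving.integral_mul_rotationDeriv (hμ : RotationPreserving μ) {k : ℤ}
    {w : E3 → ℂ} (hw : Integrable w μ)
    (hmode : ∀ s, ∀ᵐ x ∂μ, w (axisRotation s x) = character k s * w x) {φ : E3 → ℝ}
    (hφ : ContDiff ℝ ∞ φ) (hφc : HasCompactSupport φ) :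
    ∫ x, w x * rotationDeriv φ x ∂μ = -(k * Complex.I) * ∫ x, w x * φ x ∂μ := by
  obtain ⟨C, hC⟩ := hφc.exists_bound_of_continuous hφ.continuous
  obtain ⟨C', hC'⟩ := (hasCompactSupport_rotationDeriv hφc).exists_bound_of_continuous
    (continuous_rotationDeriv hφ)
  have hmeas : ∀ {ψ : E3 → ℝ}, Continuous ψ → ∀ s : ℝ,
      AEStronglyMeasurable (fun x => w x * ψ (axisRotation s x)) μ := by
    intro ψ hψ s
    have : Continuous fun x => (ψ (axisRotation s x) : ℂ) := by
      have := (contDiff_axisRotation s).continuous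
      fun_prop
    exact hw.aestronglyMeasurable.mul this.aestronglyMeasurable
  have h1 := (hasDerivAt_integral_of_dominated_loc_of_deriv_le (𝕜 := ℝ) (μ := μ) (x₀ := 0)
    (F := fun s x => w x * φ (axisRotation s x))
    (F' := fun s x => w x * rotationDeriv φ (axisRotation s x)) (bound := fun x => ‖w x‖ * C')
    univ_mem (Eventually.of_forall fun s => hmeas hφ.continuous s) ?_
    (hmeas (continuous_rotationDeriv hφ) 0) ?_ (hw.norm.mul_const C') ?_).2
  · have h2 : ∀ s, ∫ x, w x * φ (axisRotation s x) ∂μ =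
        character k (-s) * ∫ x, w x * φ x ∂μ := by
      intro s
      rw [← hμ.integral_comp s (fun x => w x * φ x), ← integral_const_mul]
      refine integral_congr_ae ?_
      filter_upwards [hmode s] with x hx
      rw [hx]
      linear_combination (-w x * φ (axisRotation s x)) * character_mul_neg k s
    have h3 : HasDerivAt (fun s : ℝ => character k (-s)) (-(k * Complex.I)) 0 := by
      have h4 : HasDerivAt (fun s : ℝ => (k : ℂ) * ((-s : ℝ) : ℂ) * Complex.I)
          (-(k * Complex.I)) 0 := by
        have := (((hasDerivAt_id (0 : ℝ)).neg.ofReal_comp).const_mul (k : ℂ)).mul_const Complex.I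
        simpa using this
      have := h4.cexp
      simpa [character] using this
    simp_rw [h2] at h1
    simpa using h1.unique (h3.mul_const _)
  · refine (hw.norm.mul_const C).mono' (hmeas hφ.continuous 0) (Eventually.of_forall fun x => ?_)
    rw [norm_mul]
    gcongr
    simpa using hC _
  · refine Eventually.of_forall fun x s _ => ?_
    rw [norm_mul]
    gcongr
    simpa using hC' _
  · exact Eventually.of_forall fun x s _ =>
      ((hasDerivAt_comp_rotation hφ s x).ofReal_comp).const_mul _

/-! ### The rotation-invariant orthonormal frame -/

lemma continuous_cross : Continuous fun p : E3 × E3 => cross p.1 p.2 := by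
  have : (fun p : E3 × E3 => cross p.1 p.2) = fun p => !₂[p.1 1 * p.2 2 - p.1 2 * p.2 1,
      p.1 2 * p.2 0 - p.1 0 * p.2 2, p.1 0 * p.2 1 - p.1 1 * p.2 0] := by
    ext p i; fin_cases i <;> simp
  rw [this]
  refine (PiLp.continuous_toLp 2 _).comp (continuous_pi fun i => ?_)
  fin_cases i <;> simp <;> fun_prop

/-- Pairings are continuous along sequences that converge in `L²`. -/
lemma tendsto_integral_mul {α : Type*} [MeasurableSpace α] {ν : Measure α} {u : α → ℂ}
    (hu : MemLp u 2 ν) {f : ℕ → α → ℝ} {g : α → ℝ} (hf : ∀ n, MemLp (f n) 2 ν)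
    (hg : MemLp g 2 ν)
    (h : Tendsto (fun n => eLpNorm (fun x => f n x - g x) 2 ν) atTop (𝓝 0)) :
    Tendsto (fun n => ∫ x, u x * f n x ∂ν) atTop (𝓝 (∫ x, u x * g x ∂ν)) := by
  have hint : ∀ {k : α → ℝ}, MemLp k 2 ν → Integrable (fun x => u x * k x) ν := fun hk =>
    hu.integrable_mul hk.ofReal
  refine tendsto_integral_of_L1 _ (hint hg).aestronglyMeasurable
    (Eventually.of_forall fun n => hint (hf n)) ?_
  have hbound : ∀ n, ∫⁻ x, ‖u x * f n x - u x * g x‖ₑ ∂ν ≤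
      eLpNorm u 2 ν * eLpNorm (fun x => f n x - g x) 2 ν := by
    intro n
    have h1 := eLpNorm_smul_le_mul_eLpNorm (p := 2) (q := 2) (r := 1)
      (((hf n).sub hg).ofReal (K := ℂ)).aestronglyMeasurable hu.aestronglyMeasurable
    rw [eLpNorm_one_eq_lintegral_enorm] at h1
    refine (le_of_eq ?_).trans (h1.trans (le_of_eq ?_))
    · congr 1; ext x; simp [mul_sub]
    · congr 1
      exact eLpNorm_congr_norm_ae (Eventually.of_forall fun x => Complex.norm_real _)
  have h0 : Tendsto (fun n => eLpNorm u 2 ν * eLpNorm (fun x => f n x - g x) 2 ν) atTop (𝓝 0) := by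
    have := ENNReal.Tendsto.const_mul h (Or.inr hu.eLpNorm_ne_top)
    simpa using this
  exact tendsto_of_tendsto_of_tendsto_of_le_of_le tendsto_const_nhds h0 (fun _ => zero_le)
    hbound

namespace ClosedSurface

variable {M : ClosedSurface} {ξ : E3 → ℝ}

variable (M) in
/-- The orthonormal frame of the tangent planes off the axis that consists of the normalized
rotation field and its image under `J`. On the axis both vectors vanish. -/
def frame (i : Fin 2) (x : E3) : E3 :=
  (Real.sqrt (axisDistSq x))⁻¹ • ![rotationField x, M.J x (rotationField x)] i

variable (M) in
/-- The derivative of `φ` along a vector of the frame. -/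
def frameDeriv (i : Fin 2) (φ : E3 → ℝ) (x : E3) : ℝ :=
  inner ℝ (M.frame i x) (M.surfaceGradient φ x)

lemma inner_eq_frame (hrot : M.IsRotationInvariant) {x v w : E3} (hx : x ∈ M.carrier)
    (hx0 : axisDistSq x ≠ 0) (hw : w ∈ M.tangentPlane x) :
    (inner ℝ v w : ℝ) = inner ℝ (M.frame 0 x) v * inner ℝ (M.frame 0 x) w +
      inner ℝ (M.frame 1 x) v * inner ℝ (M.frame 1 x) w := by
  have h := expansion_of_orthogonal (inner_normal_self hx)
    (mem_tangentPlane.1 (hrot.rotationField_mem hx)) (mem_tangentPlane.1 hw)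
  rw [inner_rotationField_self] at h
  have h1 := congrArg (fun z => (inner ℝ v z : ℝ)) h
  simp only [inner_add_right, real_inner_smul_right] at h1
  have hs : Real.sqrt (axisDistSq x) * Real.sqrt (axisDistSq x) = axisDistSq x :=
    Real.mul_self_sqrt (axisDistSq_nonneg x)
  have hs0 : Real.sqrt (axisDistSq x) ≠ 0 := fun h0 => hx0 (by rw [← hs, h0, zero_mul])
  simp only [frame, J, Matrix.cons_val_zero, Matrix.cons_val_one, real_inner_smul_left]
  rw [real_inner_comm (rotationField x) v, real_inner_comm (cross _ _) v] at h1
  field_simp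
  rw [sq, hs]
  linarith

lemma norm_frame_le (hrot : M.IsRotationInvariant) (i : Fin 2) {x : E3} (hx : x ∈ M.carrier) :
    ‖M.frame i x‖ ≤ 1 := by
  have hX : ‖rotationField x‖ = Real.sqrt (axisDistSq x) := by
    rw [← inner_rotationField_self, real_inner_self_eq_norm_sq, Real.sqrt_sq (norm_nonneg _)]
  have hJ : ‖M.J x (rotationField x)‖ = Real.sqrt (axisDistSq x) := by
    rw [← inner_rotationField_self, ← inner_cross_cross (inner_normal_self hx)
      (mem_tangentPlane.1 (hrot.rotationField_mem hx)), ← J, real_inner_self_eq_norm_sq,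
      Real.sqrt_sq (norm_nonneg _)]
  have hle : (Real.sqrt (axisDistSq x))⁻¹ * Real.sqrt (axisDistSq x) ≤ 1 := inv_mul_le_one
  rw [frame, norm_smul, norm_inv, Real.norm_of_nonneg (Real.sqrt_nonneg _)]
  fin_cases i
  · simpa [hX] using hle
  · simpa [hJ] using hle

lemma frame_axisRotation (hrot : M.IsRotationInvariant) (i : Fin 2) (s : ℝ) {x : E3}
    (hx : x ∈ M.carrier) : M.frame i (axisRotation s x) = axisRotation s (M.frame i x) := by
  have hsmul : ∀ (c : ℝ) (v : E3), axisRotation s (c • v) = c • axisRotation s v :=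
    fun c v => (rotationEquiv s).map_smul c v
  rw [frame, frame, axisDistSq_axisRotation, hsmul]
  congr 1
  fin_cases i
  · exact rotationField_axisRotation s x
  · change M.J _ _ = axisRotation s (M.J _ _)
    rw [J, J, hrot.normal s hx, rotationField_axisRotation, cross_axisRotation]

lemma frameDeriv_comp_rotation (hrot : M.IsRotationInvariant) (i : Fin 2) {φ : E3 → ℝ}
    (hφ : M.Smooth φ) (s : ℝ) {x : E3} (hx : x ∈ M.carrier) :
    M.frameDeriv i (fun y => φ (axisRotation s y)) x = M.frameDeriv i φ (axisRotation s x) := by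
  rw [frameDeriv, frameDeriv, frame_axisRotation hrot i s hx,
    ← hφ.locallySmooth.surfaceGradient_comp_rotation hrot s hx, inner_axisRotation]

lemma Smooth.comp_rotation (hrot : M.IsRotationInvariant) {φ : E3 → ℝ} (hφ : M.Smooth φ) (s : ℝ) :
    M.Smooth (fun y => φ (axisRotation s y)) := by
  obtain ⟨Φ, hΦ, heq⟩ := hφ
  exact ⟨_, hΦ.comp (contDiff_axisRotation s), fun x hx => heq (hrot s x hx)⟩

lemma aestronglyMeasurable_of_continuousOn {F : Type*} [NormedAddCommGroup F]
    [SecondCountableTopologyEither E3 F] {h : E3 → F} (hh : ContinuousOn h M.carrier) :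
    AEStronglyMeasurable h M.area :=
  hh.aestronglyMeasurable measurableSet_carrier

lemma memLp_of_continuousOn {F : Type*} [NormedAddCommGroup F]
    [SecondCountableTopologyEither E3 F] {h : E3 → F} (hh : ContinuousOn h M.carrier) :
    MemLp h 2 M.area := by
  obtain ⟨C, hC⟩ := M.isCompact_carrier.exists_bound_of_continuousOn hh
  exact MemLp.of_bound (aestronglyMeasurable_of_continuousOn hh) C
    (ae_mem_carrier.mono fun x hx => hC x hx)

lemma continuous_axisDistSq : Continuous axisDistSq := by unfold axisDistSq; fun_prop

lemma aestronglyMeasurable_frame (i : Fin 2) : AEStronglyMeasurable (M.frame i) M.area := by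
  have h1 : AEStronglyMeasurable (fun x => (Real.sqrt (axisDistSq x))⁻¹) M.area :=
    (continuous_axisDistSq.sqrt.measurable.inv).aestronglyMeasurable
  have h2 : AEStronglyMeasurable (fun x => ![rotationField x, M.J x (rotationField x)] i)
      M.area := by
    fin_cases i
    · exact contDiff_rotationField.continuous.aestronglyMeasurable
    · refine aestronglyMeasurable_of_continuousOn ?_
      exact continuous_cross.comp_continuousOn
        (locallySmooth_normal.continuousOn.prodMk contDiff_rotationField.continuous.continuousOn)
  exact h1.smul h2

lemma memLp_inner_frame (hrot : M.IsRotationInvariant) (i : Fin 2) {G : E3 → E3}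
    (hG : MemLp G 2 M.area) : MemLp (fun x => (inner ℝ (M.frame i x) (G x) : ℝ)) 2 M.area := by
  refine hG.of_le ((aestronglyMeasurable_frame i).inner hG.aestronglyMeasurable) ?_
  filter_upwards [ae_mem_carrier] with x hx
  refine (norm_inner_le_norm _ _).trans ?_
  exact mul_le_of_le_one_left (norm_nonneg _) (norm_frame_le hrot i hx)

lemma Smooth.memLp_surfaceGradient {φ : E3 → ℝ} (hφ : M.Smooth φ) :
    MemLp (M.surfaceGradient φ) 2 M.area :=
  memLp_of_continuousOn hφ.locallySmooth.surfaceGradient.continuousOn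

lemma Smooth.memLp {φ : E3 → ℝ} (hφ : M.Smooth φ) : MemLp φ 2 M.area :=
  memLp_of_continuousOn hφ.locallySmooth.continuousOn

lemma Smooth.memLp_frameDeriv (hrot : M.IsRotationInvariant) (i : Fin 2) {φ : E3 → ℝ}
    (hφ : M.Smooth φ) : MemLp (M.frameDeriv i φ) 2 M.area :=
  memLp_inner_frame hrot i hφ.memLp_surfaceGradient

/-! ### The Poisson equation in the frame -/

/-- The real Poisson equation, in terms of the components of the weak gradient in the frame. -/
lemma IsInverseLaplacian.exists_components (hrot : M.IsRotationInvariant)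
    (hξ : M.IsRotationPotential ξ) {z y : E3 → ℝ} (h : M.IsInverseLaplacian z y) :
    MemLp y 2 M.area ∧ ∃ g : Fin 2 → E3 → ℝ, (∀ i, MemLp (g i) 2 M.area) ∧
      (∀ φ, M.Smooth φ → ∫ x, z x * φ x ∂M.area =
        -∑ i, ∫ x, g i x * M.frameDeriv i φ x ∂M.area) ∧
      ∃ φ : ℕ → E3 → ℝ, (∀ n, M.Smooth (φ n)) ∧
        Tendsto (fun n => eLpNorm (fun x => φ n x - y x) 2 M.area) atTop (𝓝 0) ∧
        ∀ i, Tendsto (fun n => eLpNorm (fun x => M.frameDeriv i (φ n) x - g i x) 2 M.area)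
          atTop (𝓝 0) := by
  obtain ⟨-, G, ⟨hy, hG, φ, hφ, hφy, hφG⟩, hweak⟩ := h
  refine ⟨hy, fun i x => inner ℝ (M.frame i x) (G x), fun i => memLp_inner_frame hrot i hG,
    fun ψ hψ => ?_, φ, hφ, hφy, fun i => ?_⟩
  · have h1 : ∫ x, inner ℝ (G x) (M.surfaceGradient ψ x) ∂M.area =
        ∫ x, ∑ i, inner ℝ (M.frame i x) (G x) * M.frameDeriv i ψ x ∂M.area := by
      refine integral_congr_ae ?_
      filter_upwards [ae_mem_carrier, hξ.ae_axisDistSq_ne hrot] with x hx hx0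
      rw [Fin.sum_univ_two]
      exact inner_eq_frame hrot hx hx0 (surfaceGradient_mem _ _)
    rw [← integral_finsetSum, ← h1, hweak ψ hψ, neg_neg]
    exact fun i _ => (memLp_inner_frame hrot i hG).integrable_mul (hψ.memLp_frameDeriv hrot i)
  · refine tendsto_of_tendsto_of_tendsto_of_le_of_le tendsto_const_nhds hφG
      (fun _ => zero_le) fun n => eLpNorm_mono_ae ?_
    filter_upwards [ae_mem_carrier] with x hx
    rw [frameDeriv, ← inner_sub_right]
    refine (norm_inner_le_norm _ _).trans ?_
    exact mul_le_of_le_one_left (norm_nonneg _) (norm_frame_le hrot i hx)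

lemma integral_comp_rotation_mul (hrot : M.IsRotationInvariant) (s : ℝ) (u v : E3 → ℂ) :
    ∫ x, u (axisRotation s x) * v x ∂M.area = ∫ x, u x * v (axisRotation (-s) x) ∂M.area := by
  have hμ : RotationPreserving M.area := measurePreserving_axisRotation hrot
  rw [← hμ.integral_comp s (fun x => u x * v (axisRotation (-s) x))]
  simp

lemma memLp_add_I_mul {ν : Measure E3} {a b : E3 → ℝ} (ha : MemLp a 2 ν) (hb : MemLp b 2 ν) :
    MemLp (fun x => (a x : ℂ) + Complex.I * b x) 2 ν := by
  have ha' : MemLp (fun x => (a x : ℂ)) 2 ν := ha.ofReal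
  have hb' : MemLp (fun x => (b x : ℂ)) 2 ν := hb.ofReal
  exact ha'.add (hb'.const_mul Complex.I)

lemma integral_add_I_mul {ν : Measure E3} {a b v : E3 → ℝ} (ha : MemLp a 2 ν) (hb : MemLp b 2 ν)
    (hv : MemLp v 2 ν) :
    ∫ x, ((a x : ℂ) + Complex.I * b x) * v x ∂ν =
      ((∫ x, a x * v x ∂ν : ℝ) : ℂ) + Complex.I * ((∫ x, b x * v x ∂ν : ℝ) : ℂ) := by
  have h1 : Integrable (fun x => ((a x * v x : ℝ) : ℂ)) ν := (ha.integrable_mul hv).ofReal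
  have h2 : Integrable (fun x => ((b x * v x : ℝ) : ℂ)) ν := (hb.integrable_mul hv).ofReal
  rw [← integral_complex_ofReal, ← integral_complex_ofReal, ← integral_const_mul,
    ← integral_add h1 (h2.const_mul _)]
  refine integral_congr_ae (Eventually.of_forall fun x => ?_)
  simp only [Complex.ofReal_mul]
  ring

lemma integral_mul_conj_add {ν : Measure E3} {u : E3 → ℂ} {a b : E3 → ℝ} (hu : MemLp u 2 ν)
    (ha : MemLp a 2 ν) (hb : MemLp b 2 ν) :
    ∫ x, u x * (starRingEnd ℂ) ((a x : ℂ) + Complex.I * b x) ∂ν =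
      ∫ x, u x * (a x : ℂ) ∂ν - Complex.I * ∫ x, u x * (b x : ℂ) ∂ν := by
  have h1 : Integrable (fun x => u x * (a x : ℂ)) ν := hu.integrable_mul ha.ofReal
  have h2 : Integrable (fun x => u x * (b x : ℂ)) ν := hu.integrable_mul hb.ofReal
  rw [← integral_const_mul, ← integral_sub h1 (h2.const_mul _)]
  refine integral_congr_ae (Eventually.of_forall fun x => ?_)
  simp only [map_add, map_mul, Complex.conj_I, Complex.conj_ofReal]
  ring

/-- The weak form of `Δη = ζ` extends from smooth test functions to their limits in `H¹`. -/
lemma integral_mul_of_tendsto (hrot : M.IsRotationInvariant) {u : E3 → ℂ} {g : Fin 2 → E3 → ℂ}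
    (hu : MemLp u 2 M.area) (hg : ∀ i, MemLp (g i) 2 M.area)
    (hweak : ∀ φ, M.Smooth φ → ∫ x, u x * (φ x : ℂ) ∂M.area =
      -∑ i, ∫ x, g i x * (M.frameDeriv i φ x : ℂ) ∂M.area)
    {y : E3 → ℝ} {q : Fin 2 → E3 → ℝ} {φ : ℕ → E3 → ℝ}
    (hy : MemLp y 2 M.area) (hq : ∀ i, MemLp (q i) 2 M.area) (hφ : ∀ n, M.Smooth (φ n))
    (hφy : Tendsto (fun n => eLpNorm (fun x => φ n x - y x) 2 M.area) atTop (𝓝 0))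
    (hφq : ∀ i, Tendsto (fun n => eLpNorm (fun x => M.frameDeriv i (φ n) x - q i x) 2 M.area)
      atTop (𝓝 0)) :
    ∫ x, u x * (y x : ℂ) ∂M.area = -∑ i, ∫ x, g i x * (q i x : ℂ) ∂M.area := by
  have h1 := tendsto_integral_mul hu (fun n => (hφ n).memLp) hy hφy
  have h2 : Tendsto (fun n => -∑ i, ∫ x, g i x * (M.frameDeriv i (φ n) x : ℂ) ∂M.area)
      atTop (𝓝 (-∑ i, ∫ x, g i x * (q i x : ℂ) ∂M.area)) :=
    (tendsto_finsetSum _ fun i _ => tendsto_integral_mul (hg i)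
      (fun n => (hφ n).memLp_frameDeriv hrot i) (hq i) (hφq i)).neg
  exact tendsto_nhds_unique h1 (h2.congr fun n => (hweak (φ n) (hφ n)).symm)

/-- The weak form in the frame is invariant under rotations, because the frame is. -/
lemma integral_rotation_mul (hrot : M.IsRotationInvariant) {u : E3 → ℂ} {g : Fin 2 → E3 → ℂ}
    (hweak : ∀ φ, M.Smooth φ → ∫ x, u x * (φ x : ℂ) ∂M.area =
      -∑ i, ∫ x, g i x * (M.frameDeriv i φ x : ℂ) ∂M.area) (s : ℝ) {φ : E3 → ℝ}
    (hφ : M.Smooth φ) :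
    ∫ x, u (axisRotation s x) * (φ x : ℂ) ∂M.area =
      -∑ i, ∫ x, g i (axisRotation s x) * (M.frameDeriv i φ x : ℂ) ∂M.area := by
  rw [integral_comp_rotation_mul hrot s u (fun x => (φ x : ℂ)),
    hweak _ (hφ.comp_rotation hrot (-s))]
  congr 1
  refine Finset.sum_congr rfl fun i _ => ?_
  rw [integral_comp_rotation_mul hrot s (g i) (fun x => (M.frameDeriv i φ x : ℂ))]
  refine integral_congr_ae ?_
  filter_upwards [ae_mem_carrier] with x hx
  rw [frameDeriv_comp_rotation hrot i hφ (-s) hx]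

/-- The complex Poisson equation `Δη = ζ`, in terms of the components of the weak gradient in the
frame: the weak form, and the correlations of `ζ` and `η` along the rotations. -/
lemma exists_components (hrot : M.IsRotationInvariant) (hξ : M.IsRotationPotential ξ)
    {ζ η : E3 → ℂ} (hζ : MemLp ζ 2 M.area)
    (hre : M.IsInverseLaplacian (fun x => (ζ x).re) (fun x => (η x).re))
    (him : M.IsInverseLaplacian (fun x => (ζ x).im) (fun x => (η x).im)) :
    MemLp η 2 M.area ∧ ∃ g : Fin 2 → E3 → ℂ, (∀ i, MemLp (g i) 2 M.area) ∧
      (∀ s φ, M.Smooth φ → ∫ x, ζ (axisRotation s x) * (φ x : ℂ) ∂M.area =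
        -∑ i, ∫ x, g i (axisRotation s x) * (M.frameDeriv i φ x : ℂ) ∂M.area) ∧
      ∀ s, ∫ x, ζ (axisRotation s x) * (starRingEnd ℂ) (η x) ∂M.area =
        -∑ i, ∫ x, g i (axisRotation s x) * (starRingEnd ℂ) (g i x) ∂M.area := by
  have hμ := measurePreserving_axisRotation hrot
  obtain ⟨hyr, gr, hgr, hwr, φr, hφr, hlr, hdr⟩ := hre.exists_components hrot hξ
  obtain ⟨hyi, gi, hgi, hwi, φi, hφi, hli, hdi⟩ := him.exists_components hrot hξ
  have hη0 : η = fun x => ((η x).re : ℂ) + Complex.I * ((η x).im : ℂ) := funext fun x => by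
    rw [mul_comm]; exact (Complex.re_add_im _).symm
  have hζ0 : ζ = fun x => ((ζ x).re : ℂ) + Complex.I * ((ζ x).im : ℂ) := funext fun x => by
    rw [mul_comm]; exact (Complex.re_add_im _).symm
  have hη : MemLp η 2 M.area := by
    rw [hη0]
    exact memLp_add_I_mul hyr hyi
  have hζr : MemLp (fun x => (ζ x).re) 2 M.area := hζ.re
  have hζi : MemLp (fun x => (ζ x).im) 2 M.area := hζ.im
  obtain ⟨g, hg0⟩ : ∃ g : Fin 2 → E3 → ℂ, ∀ i, g i = fun x => (gr i x : ℂ) + Complex.I * gi i x :=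
    ⟨_, fun i => rfl⟩
  have hg : ∀ i, MemLp (g i) 2 M.area := fun i => by
    rw [hg0]
    exact memLp_add_I_mul (hgr i) (hgi i)
  have hweak : ∀ φ, M.Smooth φ → ∫ x, ζ x * (φ x : ℂ) ∂M.area =
      -∑ i, ∫ x, g i x * (M.frameDeriv i φ x : ℂ) ∂M.area := by
    intro φ hφ
    have h1 : ∫ x, ζ x * (φ x : ℂ) ∂M.area = ((∫ x, (ζ x).re * φ x ∂M.area : ℝ) : ℂ) +
        Complex.I * ((∫ x, (ζ x).im * φ x ∂M.area : ℝ) : ℂ) := by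
      rw [← integral_add_I_mul hζr hζi hφ.memLp]
      refine integral_congr_ae (Eventually.of_forall fun x => ?_)
      simp only [← congrFun hζ0 x]
    have h2 : ∀ i, ∫ x, g i x * (M.frameDeriv i φ x : ℂ) ∂M.area =
        ((∫ x, gr i x * M.frameDeriv i φ x ∂M.area : ℝ) : ℂ) +
        Complex.I * ((∫ x, gi i x * M.frameDeriv i φ x ∂M.area : ℝ) : ℂ) := by
      intro i
      rw [hg0]
      exact integral_add_I_mul (hgr i) (hgi i) (hφ.memLp_frameDeriv hrot i)
    rw [h1, hwr φ hφ, hwi φ hφ, Fin.sum_univ_two, Fin.sum_univ_two, Fin.sum_univ_two, h2, h2]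
    push_cast
    ring
  refine ⟨hη, g, hg, fun s φ hφ => integral_rotation_mul hrot hweak s hφ, fun s => ?_⟩
  have hζs := hζ.comp_measurePreserving (hμ s)
  have hgs : ∀ i, MemLp (g i ∘ axisRotation s) 2 M.area :=
    fun i => (hg i).comp_measurePreserving (hμ s)
  have hws := fun φ (hφ : M.Smooth φ) => integral_rotation_mul hrot hweak s hφ
  have h1 := integral_mul_of_tendsto hrot hζs hgs hws hyr hgr hφr hlr hdr
  have h2 := integral_mul_of_tendsto hrot hζs hgs hws hyi hgi hφi hli hdi
  have h3 : ∫ x, ζ (axisRotation s x) * (starRingEnd ℂ) (η x) ∂M.area =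
      ∫ x, (ζ ∘ axisRotation s) x * ((η x).re : ℂ) ∂M.area -
        Complex.I * ∫ x, (ζ ∘ axisRotation s) x * ((η x).im : ℂ) ∂M.area := by
    rw [← integral_mul_conj_add hζs hyr hyi]
    refine integral_congr_ae (Eventually.of_forall fun x => ?_)
    simp only [Function.comp_apply, ← congrFun hη0 x]
  have h4 : ∀ i, ∫ x, g i (axisRotation s x) * (starRingEnd ℂ) (g i x) ∂M.area =
      ∫ x, (g i ∘ axisRotation s) x * (gr i x : ℂ) ∂M.area -
        Complex.I * ∫ x, (g i ∘ axisRotation s) x * (gi i x : ℂ) ∂M.area := by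
    intro i
    rw [← integral_mul_conj_add (hgs i) (hgr i) (hgi i)]
    refine integral_congr_ae (Eventually.of_forall fun x => ?_)
    simp only [Function.comp_apply, congrFun (hg0 i) x]
  rw [h3, h1, h2, Fin.sum_univ_two, Fin.sum_univ_two, Fin.sum_univ_two, h4, h4]
  ring

/-- The energy identity for a nonzero mode. The correlations along the rotations split into modes, and
in the rotation-invariant frame so does the weak Poisson equation, with energy
`E = ∑ i, ‖mode k (g i)‖²`, where the `g i` are the components of the weak gradient of `η`. If the
energy were zero, the weak equation would give `mode k ζ = 0`. -/
theorem exists_energy (hrot : M.IsRotationInvariant) (hξ : M.IsRotationPotential ξ)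
    {ζ η : E3 → ℂ} (hζ : MemLp ζ 2 M.area)
    (hre : M.IsInverseLaplacian (fun x => (ζ x).re) (fun x => (η x).re))
    (him : M.IsInverseLaplacian (fun x => (ζ x).im) (fun x => (η x).im)) {k : ℤ}
    (hk : ¬ mode k ζ =ᵐ[M.area] 0) :
    MemLp η 2 M.area ∧ ∃ E : ℝ, 0 < E ∧
      ∫ x, mode k ζ x * (starRingEnd ℂ) (mode k η x) ∂M.area = ((-E : ℝ) : ℂ) := by
  have hμ : RotationPreserving M.area := measurePreserving_axisRotation hrot
  obtain ⟨hη, g, hg, hweak, hcorr⟩ := exists_components hrot hξ hζ hre him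
  refine ⟨hη, ∑ i, ∫ x, ‖mode k (g i) x‖ ^ 2 ∂M.area, ?_, ?_⟩
  · have hnn : ∀ i, 0 ≤ ∫ x, ‖mode k (g i) x‖ ^ 2 ∂M.area :=
      fun i => integral_nonneg fun x => by positivity
    refine lt_of_le_of_ne (Finset.sum_nonneg fun i _ => hnn i) fun h0 => hk ?_
    have hz : ∀ i, mode k (g i) =ᵐ[M.area] 0 := by
      intro i
      have h1 := (Finset.sum_eq_zero_iff_of_nonneg fun i _ => hnn i).1 h0.symm i (Finset.mem_univ i)
      have h2 := hμ.memLp_mode k (hg i)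
      rw [integral_eq_zero_iff_of_nonneg (fun x => by positivity)
        ((memLp_two_iff_integrable_sq_norm h2.aestronglyMeasurable).1 h2)] at h1
      filter_upwards [h1] with x hx
      simpa using hx
    refine ae_eq_zero_of_integral_mul_eq_zero ((hμ.memLp_mode k hζ).integrable (by norm_num))
      fun φ hφ _ => ?_
    have hφM : M.Smooth φ := ⟨φ, hφ, fun x _ => rfl⟩
    have hφL : MemLp (fun x => (φ x : ℂ)) 2 M.area := hφM.memLp.ofReal
    have hφF : ∀ i, MemLp (fun x => (M.frameDeriv i φ x : ℂ)) 2 M.area :=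
      fun i => (hφM.memLp_frameDeriv hrot i).ofReal
    rw [hμ.integral_mode_mul k hζ hφL]
    have h3 : ∀ i, ∫ s, character k (-s) *
        ∫ x, g i (axisRotation s x) * M.frameDeriv i φ x ∂M.area ∂angleMeasure = 0 := by
      intro i
      rw [← hμ.integral_mode_mul k (hg i) (hφF i)]
      refine integral_eq_zero_of_ae ?_
      filter_upwards [hz i] with x hx
      simp [hx]
    have h4 : ∀ s, character k (-s) * ∫ x, ζ (axisRotation s x) * φ x ∂M.area =
        -∑ i, character k (-s) * ∫ x, g i (axisRotation s x) * M.frameDeriv i φ x ∂M.area := by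
      intro s
      rw [hweak s φ hφM, mul_neg, Finset.mul_sum]
    simp_rw [h4]
    rw [integral_neg, integral_finsetSum]
    · simp [h3]
    · exact fun i _ => hμ.integrable_pairing k (hg i) (hφF i)
  · rw [hμ.integral_mode_mul_conj k hζ hη]
    have h4 : ∀ s, character k (-s) * ∫ x, ζ (axisRotation s x) * (starRingEnd ℂ) (η x) ∂M.area =
        -∑ i, character k (-s) *
          ∫ x, g i (axisRotation s x) * (starRingEnd ℂ) (g i x) ∂M.area := by
      intro s
      rw [hcorr s, mul_neg, Finset.mul_sum]
    simp_rw [h4]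
    rw [integral_neg, integral_finsetSum]
    · push_cast
      congr 1
      refine Finset.sum_congr rfl fun i _ => ?_
      rw [← hμ.integral_mode_mul_conj k (hg i) (hg i), ← integral_complex_ofReal]
      congr 1; ext x
      rw [Complex.mul_conj, Complex.normSq_eq_norm_sq]
    · exact fun i _ => hμ.integrable_pairing k (hg i) (memLp_conj (hg i))

end ClosedSurface

lemma axisRotation_comm (s t : ℝ) (x : E3) :
    axisRotation s (axisRotation t x) = axisRotation t (axisRotation s x) := by
  rw [← axisRotation_add, ← axisRotation_add, add_comm]

namespace ClosedSurface

variable {M : ClosedSurface} {ξ : E3 → ℝ} {α₀ α₁ : ℝ}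

/-! ### The equation for a mode -/

lemma rotationDeriv_axisDistSq_mul {φ : E3 → ℝ} (hφ : ContDiff ℝ ∞ φ) (s : ℝ) (x : E3) :
    rotationDeriv (fun y => axisDistSq y * φ (axisRotation (-s) y)) x =
      axisDistSq x * rotationDeriv φ (axisRotation (-s) x) := by
  have hr : ContDiff ℝ ∞ axisDistSq := by unfold axisDistSq; fun_prop
  have h1 := hasDerivAt_comp_rotation
    (hr.mul (hφ.comp (contDiff_axisRotation (-s)))) 0 x
  have h2 := (hasDerivAt_comp_rotation hφ 0 (axisRotation (-s) x)).const_mul (axisDistSq x)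
  simp only [axisRotation_by_zero] at h1 h2
  refine h1.unique (h2.congr_of_eventuallyEq (Eventually.of_forall fun t => ?_))
  simp only [Function.comp_apply, axisDistSq_axisRotation, axisRotation_comm (-s) t x]

/-- Differentiation along `J∇h`, for a function `h = F(ξ)`, is differentiation along `-F'(ξ) X₃`. -/
lemma inner_J_surfaceGradient (hrot : M.IsRotationInvariant) (hξ : M.IsRotationPotential ξ)
    {F : ℝ → ℝ} {h : E3 → ℝ} (hF : ∀ x ∈ M.carrier, h x = F (ξ x)) {x : E3}
    (hx : x ∈ M.carrier) (hd : DifferentiableAt ℝ F (ξ x)) {ψ : E3 → ℝ} (hψ : ContDiff ℝ ∞ ψ) :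
    inner ℝ (M.J x (M.surfaceGradient h x)) (M.surfaceGradient ψ x) =
      -(deriv F (ξ x) * rotationDeriv ψ x) := by
  rw [surfaceGradient_comp hξ hF hx hd, J, cross_smul, ← J, hξ.2 x hx, real_inner_smul_left,
    inner_neg_left, real_inner_comm, inner_surfaceGradient hx
      (hψ.differentiable (by simp) x).hasFDerivAt.hasFDerivWithinAt (hrot.rotationField_mem hx),
    rotationDeriv]
  ring

variable (M ξ) in
/-- The density `⟨∇h, ∇ξ⟩`. If `h = F(ξ)`, it equals `r² F'(ξ)`, where `r` is the distance to the
axis. It is continuous on the whole surface, whereas `F'(ξ)` is controlled off the axis only. -/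
def slope (h : E3 → ℝ) (x : E3) : ℝ :=
  inner ℝ (M.surfaceGradient h x) (M.surfaceGradient ξ x)

lemma LocallySmooth.continuousOn_slope (hξ : M.IsRotationPotential ξ) {h : E3 → ℝ}
    (hh : M.LocallySmooth h) : ContinuousOn (M.slope ξ h) M.carrier :=
  hh.surfaceGradient.continuousOn.inner hξ.1.locallySmooth.surfaceGradient.continuousOn

lemma slope_rotation (hrot : M.IsRotationInvariant) (hξ : M.IsRotationPotential ξ) {h : E3 → ℝ}
    (hh : M.LocallySmooth h) (hinv : ∀ s, ∀ x ∈ M.carrier, h (axisRotation s x) = h x) (s : ℝ)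
    {x : E3} (hx : x ∈ M.carrier) : M.slope ξ h (axisRotation s x) = M.slope ξ h x := by
  rw [slope, hh.surfaceGradient_rotation hrot hinv s hx,
    hξ.1.locallySmooth.surfaceGradient_rotation hrot
      (fun s x hx => hξ.isZonal.rotation_eq hrot s hx) s hx, inner_axisRotation, slope]

lemma slope_eq (hrot : M.IsRotationInvariant) (hξ : M.IsRotationPotential ξ)
    {F : ℝ → ℝ} {h : E3 → ℝ} (hF : ∀ x ∈ M.carrier, h x = F (ξ x)) {x : E3}
    (hx : x ∈ M.carrier) (hd : DifferentiableAt ℝ F (ξ x)) :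
    M.slope ξ h x = deriv F (ξ x) * axisDistSq x := by
  rw [slope, surfaceGradient_comp hξ hF hx hd, real_inner_smul_left, hξ.inner_self hrot hx]

lemma contDiff_axisDistSq_mul_rotation {φ : E3 → ℝ} (hφ : ContDiff ℝ ∞ φ) (s : ℝ) :
    ContDiff ℝ ∞ (fun y => axisDistSq y * φ (axisRotation (-s) y)) := by
  have hr : ContDiff ℝ ∞ axisDistSq := by unfold axisDistSq; fun_prop
  exact hr.mul (hφ.comp (contDiff_axisRotation (-s)))

/-- The transport term of the linearized equation, tested with `r² φ ∘ R₋ₛ`. The factor `r²`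
compensates for the possible growth of `F'(ξ)` at the axis. -/
lemma integral_mul_inner_J (hrot : M.IsRotationInvariant) (hξ : M.IsRotationPotential ξ)
    (hα₀ : IsLeast (ξ '' M.carrier) α₀) (hα₁ : IsGreatest (ξ '' M.carrier) α₁)
    {h : E3 → ℝ} (hh : M.LocallySmooth h) {F : ℝ → ℝ} (hFs : ContDiffOn ℝ ∞ F (Ioo α₀ α₁))
    (hF : ∀ x ∈ M.carrier, h x = F (ξ x)) (u : E3 → ℂ) {φ : E3 → ℝ} (hφ : ContDiff ℝ ∞ φ)
    (s : ℝ) :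
    ∫ x, u x * ((inner ℝ (M.J x (M.surfaceGradient h x)) (M.surfaceGradient
        (fun y => axisDistSq y * φ (axisRotation (-s) y)) x) : ℝ) : ℂ) ∂M.area =
      -∫ x, u (axisRotation s x) * ((M.slope ξ h x * rotationDeriv φ x : ℝ) : ℂ) ∂M.area := by
  have hinv : ∀ s, ∀ x ∈ M.carrier, h (axisRotation s x) = h x := fun s x hx => by
    rw [hF _ (hrot s x hx), hF x hx, hξ.isZonal.rotation_eq hrot s hx]
  rw [integral_comp_rotation_mul hrot s u
    (fun x => ((M.slope ξ h x * rotationDeriv φ x : ℝ) : ℂ)), ← integral_neg]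
  refine integral_congr_ae ?_
  filter_upwards [ae_mem_carrier, hξ.ae_axisDistSq_ne hrot] with x hx hx0
  have hd : DifferentiableAt ℝ F (ξ x) :=
    (hFs.contDiffAt (isOpen_Ioo.mem_nhds (hξ.mem_Ioo hrot hα₀ hα₁ hx hx0))).differentiableAt
      (by simp)
  rw [inner_J_surfaceGradient hrot hξ hF hx hd (contDiff_axisDistSq_mul_rotation hφ s),
    rotationDeriv_axisDistSq_mul hφ, slope_rotation hrot hξ hh hinv _ hx,
    slope_eq hrot hξ hF hx hd, ← mul_assoc, Complex.ofReal_neg, mul_neg]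

/-- Each angular mode of an eigenfunction satisfies a pointwise linear equation. -/
theorem ae_mode_equation (hrot : M.IsRotationInvariant) (hξ : M.IsRotationPotential ξ)
    (hα₀ : IsLeast (ξ '' M.carrier) α₀) (hα₁ : IsGreatest (ξ '' M.carrier) α₁)
    {f q : E3 → ℝ} (hf : M.LocallySmooth f) (hq : M.LocallySmooth q) {F Q : ℝ → ℝ}
    (hFs : ContDiffOn ℝ ∞ F (Ioo α₀ α₁)) (hQs : ContDiffOn ℝ ∞ Q (Ioo α₀ α₁))
    (hF : ∀ x ∈ M.carrier, f x = F (ξ x)) (hQ : ∀ x ∈ M.carrier, q x = Q (ξ x))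
    {ζ η : E3 → ℂ} (hζ : MemLp ζ 2 M.area) (hη : MemLp η 2 M.area) {lam : ℂ}
    (heq : ∀ φ : E3 → ℝ, M.Smooth φ → ∫ x, lam * ζ x * (φ x : ℂ) ∂M.area =
      (∫ x, ζ x * ((inner ℝ (M.J x (M.surfaceGradient f x))
        (M.surfaceGradient φ x) : ℝ) : ℂ) ∂M.area) -
      ∫ x, η x * ((inner ℝ (M.J x (M.surfaceGradient q x))
        (M.surfaceGradient φ x) : ℝ) : ℂ) ∂M.area) (k : ℤ) :
    ∀ᵐ x ∂M.area, lam * mode k ζ x = k * Complex.I *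
      ((deriv F (ξ x) : ℝ) * mode k ζ x - (deriv Q (ξ x) : ℝ) * mode k η x) := by
  have hμ : RotationPreserving M.area := measurePreserving_axisRotation hrot
  have hinvF : ∀ s, ∀ x ∈ M.carrier, f (axisRotation s x) = f x := fun s x hx => by
    rw [hF _ (hrot s x hx), hF x hx, hξ.isZonal.rotation_eq hrot s hx]
  have hinvQ : ∀ s, ∀ x ∈ M.carrier, q (axisRotation s x) = q x := fun s x hx => by
    rw [hQ _ (hrot s x hx), hQ x hx, hξ.isZonal.rotation_eq hrot s hx]
  have hof : ∀ {v : E3 → ℝ}, ContinuousOn v M.carrier →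
      MemLp (fun x => (v x : ℂ)) 2 M.area := fun hv => (memLp_of_continuousOn hv).ofReal
  have hζk := hμ.memLp_mode k hζ
  have hηk := hμ.memLp_mode k hη
  have hbf := hf.continuousOn_slope hξ
  have hbq := hq.continuousOn_slope hξ
  have hr := continuous_axisDistSq.continuousOn (s := M.carrier)
  have hwf : Integrable (fun x => mode k ζ x * (M.slope ξ f x : ℂ)) M.area :=
    hζk.integrable_mul (hof hbf)
  have hwq : Integrable (fun x => mode k η x * (M.slope ξ q x : ℂ)) M.area :=
    hηk.integrable_mul (hof hbq)
  have hwr : Integrable (fun x => mode k ζ x * (axisDistSq x : ℂ)) M.area :=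
    hζk.integrable_mul (hof hr)
  -- The equation integrated against a test function, in the `k`-th mode.
  have hmain : ∀ φ : E3 → ℝ, ContDiff ℝ ∞ φ → HasCompactSupport φ →
      lam * ∫ x, mode k ζ x * (axisDistSq x : ℂ) * (φ x : ℂ) ∂M.area =
        k * Complex.I * (∫ x, mode k ζ x * (M.slope ξ f x : ℂ) * (φ x : ℂ) ∂M.area -
          ∫ x, mode k η x * (M.slope ξ q x : ℂ) * (φ x : ℂ) ∂M.area) := by
    intro φ hφ hφc
    have hφ' := (continuous_rotationDeriv hφ).continuousOn (s := M.carrier)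
    have hv1 : MemLp (fun x => ((axisDistSq x * φ x : ℝ) : ℂ)) 2 M.area := hof (hr.mul hφ.continuous.continuousOn)
    have hv2 : MemLp (fun x => ((M.slope ξ f x * rotationDeriv φ x : ℝ) : ℂ)) 2 M.area :=
      hof (hbf.mul hφ')
    have hv3 : MemLp (fun x => ((M.slope ξ q x * rotationDeriv φ x : ℝ) : ℂ)) 2 M.area :=
      hof (hbq.mul hφ')
    have hs : ∀ s, lam * (character k (-s) * ∫ x, ζ (axisRotation s x) *
          ((axisDistSq x * φ x : ℝ) : ℂ) ∂M.area) =
        character k (-s) * (∫ x, η (axisRotation s x) *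
          ((M.slope ξ q x * rotationDeriv φ x : ℝ) : ℂ) ∂M.area) -
        character k (-s) * ∫ x, ζ (axisRotation s x) *
          ((M.slope ξ f x * rotationDeriv φ x : ℝ) : ℂ) ∂M.area := by
      intro s
      have h1 := heq _ ⟨_, contDiff_axisDistSq_mul_rotation hφ s, fun x _ => rfl⟩
      rw [integral_mul_inner_J hrot hξ hα₀ hα₁ hf hFs hF ζ hφ s,
        integral_mul_inner_J hrot hξ hα₀ hα₁ hq hQs hQ η hφ s] at h1
      have h2 : ∫ x, lam * ζ x * ((axisDistSq x * φ (axisRotation (-s) x) : ℝ) : ℂ) ∂M.area =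
          lam * ∫ x, ζ (axisRotation s x) * ((axisDistSq x * φ x : ℝ) : ℂ) ∂M.area := by
        rw [integral_comp_rotation_mul hrot s ζ (fun x => ((axisDistSq x * φ x : ℝ) : ℂ)),
          ← integral_const_mul]
        refine integral_congr_ae (Eventually.of_forall fun x => ?_)
        simp only [axisDistSq_axisRotation, mul_assoc]
      rw [h2] at h1
      linear_combination character k (-s) * h1
    have hint : lam * ∫ x, mode k ζ x * ((axisDistSq x * φ x : ℝ) : ℂ) ∂M.area =
        (∫ x, mode k η x * ((M.slope ξ q x * rotationDeriv φ x : ℝ) : ℂ) ∂M.area) -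
        ∫ x, mode k ζ x * ((M.slope ξ f x * rotationDeriv φ x : ℝ) : ℂ) ∂M.area := by
      rw [hμ.integral_mode_mul k hζ hv1, hμ.integral_mode_mul k hη hv3,
        hμ.integral_mode_mul k hζ hv2, ← integral_sub (hμ.integrable_pairing k hη hv3)
          (hμ.integrable_pairing k hζ hv2), ← integral_const_mul]
      exact integral_congr_ae (Eventually.of_forall hs)
    have hdf := hμ.integral_mul_rotationDeriv (k := k) hwf (fun s => by
      filter_upwards [ae_mem_carrier] with x hx
      rw [mode_axisRotation, slope_rotation hrot hξ hf hinvF s hx, mul_assoc]) hφ hφc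
    have hdq := hμ.integral_mul_rotationDeriv (k := k) hwq (fun s => by
      filter_upwards [ae_mem_carrier] with x hx
      rw [mode_axisRotation, slope_rotation hrot hξ hq hinvQ s hx, mul_assoc]) hφ hφc
    simp only [Complex.ofReal_mul, ← mul_assoc] at hint
    rw [hint, hdf, hdq]
    ring
  have hzero := ae_eq_zero_of_integral_mul_eq_zero
    (u := fun x => lam * (mode k ζ x * (axisDistSq x : ℂ)) - k * Complex.I *
      (mode k ζ x * (M.slope ξ f x : ℂ) - mode k η x * (M.slope ξ q x : ℂ)))
    ((hwr.const_mul lam).sub ((hwf.sub hwq).const_mul _)) fun φ hφ hφc => by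
      obtain ⟨C, hC⟩ := hφc.exists_bound_of_continuous hφ.continuous
      have hb : ∀ {w : E3 → ℂ}, Integrable w M.area →
          Integrable (fun x => w x * (φ x : ℂ)) M.area := fun hw =>
        hw.mul_bdd (c := C) (by have := hφ.continuous; fun_prop)
          (Eventually.of_forall fun x => by simpa using hC x)
      have h1 : ∀ x, (lam * (mode k ζ x * (axisDistSq x : ℂ)) - k * Complex.I *
          (mode k ζ x * (M.slope ξ f x : ℂ) - mode k η x * (M.slope ξ q x : ℂ))) * (φ x : ℂ) =
          lam * (mode k ζ x * (axisDistSq x : ℂ) * (φ x : ℂ)) - k * Complex.I *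
          (mode k ζ x * (M.slope ξ f x : ℂ) * (φ x : ℂ) -
            mode k η x * (M.slope ξ q x : ℂ) * (φ x : ℂ)) := fun x => by ring
      simp_rw [h1]
      have h2 : Integrable (fun x => mode k ζ x * (M.slope ξ f x : ℂ) * (φ x : ℂ) -
          mode k η x * (M.slope ξ q x : ℂ) * (φ x : ℂ)) M.area := (hb hwf).sub (hb hwq)
      rw [integral_sub ((hb hwr).const_mul _) (h2.const_mul _),
        integral_const_mul, integral_const_mul, integral_sub (hb hwf) (hb hwq), hmain φ hφ hφc,
        sub_self]
  filter_upwards [hzero, ae_mem_carrier, hξ.ae_axisDistSq_ne hrot] with x h0 hx hx0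
  have hI := isOpen_Ioo.mem_nhds (hξ.mem_Ioo hrot hα₀ hα₁ hx hx0)
  rw [slope_eq hrot hξ hF hx ((hFs.contDiffAt hI).differentiableAt (by simp)),
    slope_eq hrot hξ hQ hx ((hQs.contDiffAt hI).differentiableAt (by simp))] at h0
  have hx0' : (axisDistSq x : ℂ) ≠ 0 := Complex.ofReal_ne_zero.2 hx0
  refine mul_right_cancel₀ hx0' ?_
  simp only [Pi.zero_apply, Complex.ofReal_mul] at h0
  linear_combination h0

end ClosedSurface

/-! ### The sign conditions -/

/-- The real and imaginary parts of the equation for a mode, multiplied by the conjugate of `b`. -/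
lemma mode_equation_parts {a b lam : ℂ} {k P G : ℝ}
    (h : lam * a = k * Complex.I * (P * a - G * b)) :
    lam.re * (a * (starRingEnd ℂ) b).re = (lam.im - k * P) * (a * (starRingEnd ℂ) b).im ∧
      (lam.im - k * P) * (a * (starRingEnd ℂ) b).re + lam.re * (a * (starRingEnd ℂ) b).im =
        -(k * G * Complex.normSq b) := by
  have hre := congrArg Complex.re h
  have him := congrArg Complex.im h
  simp at hre him
  simp [Complex.normSq_apply]
  constructor
  · linear_combination b.re * hre + b.im * him
  · linear_combination b.re * him - b.im * hre

variable {α : Type*} [MeasurableSpace α] {ν : Measure α}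

/-- Let the real part of the correlation `a b̄` have a negative integral, and its imaginary part
integral zero. The equation forces the sign of `Im (a b̄)` to be that of `-k Re(λ) G`, so `G` cannot
have a constant sign; and `Re (a b̄) + c Im (a b̄)` has the sign of `G (P - K)` for a suitable
constant `c`. -/
lemma sign_conditions {a b : α → ℂ} (ha : MemLp a 2 ν) (hb : MemLp b 2 ν) {P G : α → ℝ} {lam : ℂ}
    (hlam : lam.re ≠ 0) {k : ℝ}
    (h : ∀ᵐ x ∂ν, lam * a x = k * Complex.I * (P x * a x - G x * b x)) {E : ℝ} (hE : 0 < E)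
    (hint : ∫ x, a x * (starRingEnd ℂ) (b x) ∂ν = ((-E : ℝ) : ℂ)) :
    (∀ σ : ℝ, σ ≠ 0 → ¬ ∀ᵐ x ∂ν, 0 ≤ σ * G x) ∧
      ∀ K : ℝ, ¬ ∀ᵐ x ∂ν, 0 ≤ G x * (P x - K) := by
  have hL : Integrable (fun x => a x * (starRingEnd ℂ) (b x)) ν :=
    ha.integrable_mul (hb.star)
  have hLr : Integrable (fun x => (a x * (starRingEnd ℂ) (b x)).re) ν := hL.re
  have hLi : Integrable (fun x => (a x * (starRingEnd ℂ) (b x)).im) ν := hL.im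
  have hr : ∫ x, (a x * (starRingEnd ℂ) (b x)).re ∂ν = -E := by
    have := congrArg Complex.re hint
    rw [Complex.ofReal_re] at this
    rw [← this]
    exact integral_re hL
  have hi : ∫ x, (a x * (starRingEnd ℂ) (b x)).im ∂ν = 0 := by
    have := congrArg Complex.im hint
    rw [Complex.ofReal_im] at this
    rw [← this]
    exact integral_im hL
  have hD : ∀ t : ℝ, 0 < lam.re ^ 2 + t ^ 2 := fun t => by positivity
  have hk : k ≠ 0 := by
    rintro rfl
    have h0 : ∫ x, a x * (starRingEnd ℂ) (b x) ∂ν = 0 := by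
      refine integral_eq_zero_of_ae ?_
      filter_upwards [h] with x hx
      have hl : lam ≠ 0 := fun h0 => hlam (by simp [h0])
      have : a x = 0 := by simpa [hl] using hx
      simp [this]
    rw [hint, Complex.ofReal_eq_zero] at h0
    linarith
  refine ⟨fun σ hσ hG => ?_, fun K hG => ?_⟩
  · have hnn : 0 ≤ᵐ[ν] fun x => -(σ * lam.re * k) * (a x * (starRingEnd ℂ) (b x)).im := by
      filter_upwards [h, hG] with x hx hGx
      obtain ⟨h1, h2⟩ := mode_equation_parts hx
      have h3 : (lam.re ^ 2 + (lam.im - k * P x) ^ 2) *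
          (-(σ * lam.re * k) * (a x * (starRingEnd ℂ) (b x)).im) =
          (lam.re * k) ^ 2 * Complex.normSq (b x) * (σ * G x) := by
        linear_combination (σ * lam.re * k) * (lam.im - k * P x) * h1 -
          (σ * lam.re ^ 2 * k) * h2
      have h4 : 0 ≤ (lam.re * k) ^ 2 * Complex.normSq (b x) * (σ * G x) :=
        mul_nonneg (mul_nonneg (sq_nonneg _) (Complex.normSq_nonneg _)) hGx
      rw [← h3] at h4
      exact nonneg_of_mul_nonneg_right h4 (hD _)
    have hz := (integral_eq_zero_iff_of_nonneg_ae hnn (hLi.const_mul _)).1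
      (by rw [integral_const_mul, hi, mul_zero])
    have h0 : ∫ x, (a x * (starRingEnd ℂ) (b x)).re ∂ν = 0 := by
      refine integral_eq_zero_of_ae ?_
      filter_upwards [h, hz] with x hx hzx
      obtain ⟨h1, -⟩ := mode_equation_parts hx
      have h2 : (a x * (starRingEnd ℂ) (b x)).im = 0 := by
        refine (mul_eq_zero.1 hzx).resolve_left ?_
        simp [hσ, hlam, hk]
      rw [h2, mul_zero] at h1
      exact (mul_eq_zero.1 h1).resolve_left hlam
    linarith
  · have hnn : 0 ≤ᵐ[ν] fun x => (a x * (starRingEnd ℂ) (b x)).re +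
        (k * K - lam.im) / lam.re * (a x * (starRingEnd ℂ) (b x)).im := by
      -- By the first part of the equation, `Re (a b̄) = (Im λ - k P) Im (a b̄) / Re λ`. The constant
      -- is chosen such that `Im λ` cancels and `P - K` appears.
      filter_upwards [h, hG] with x hx hGx
      obtain ⟨h1, h2⟩ := mode_equation_parts hx
      have h3 : (lam.re ^ 2 + (lam.im - k * P x) ^ 2) * ((a x * (starRingEnd ℂ) (b x)).re +
          (k * K - lam.im) / lam.re * (a x * (starRingEnd ℂ) (b x)).im) =
          k ^ 2 * Complex.normSq (b x) * (G x * (P x - K)) := by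
        field_simp
        linear_combination (lam.re ^ 2 + (lam.im - k * P x) ^ 2 -
          k * (K - P x) * (lam.im - k * P x)) * h1 + lam.re * k * (K - P x) * h2
      have h4 : 0 ≤ k ^ 2 * Complex.normSq (b x) * (G x * (P x - K)) :=
        mul_nonneg (mul_nonneg (sq_nonneg _) (Complex.normSq_nonneg _)) hGx
      rw [← h3] at h4
      exact nonneg_of_mul_nonneg_right h4 (hD _)
    have h5 := integral_nonneg_of_ae hnn
    rw [integral_add hLr (hLi.const_mul _), integral_const_mul, hi, hr] at h5
    linarith

end RotatingSurface

end

open RotatingSurface RotatingSurface.ClosedSurface in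
theorem proposition4p2p3
    (M : RotatingSurface.ClosedSurface)
    (hrot : M.IsRotationInvariant) (hcurv : M.HasPositiveCurvature)
    (ξ : RotatingSurface.E3 → ℝ) (hξ : M.IsRotationPotential ξ)
    (α₀ α₁ : ℝ) (hα₀ : IsLeast (ξ '' M.carrier) α₀) (hα₁ : IsGreatest (ξ '' M.carrier) α₁)
    (f : RotatingSurface.E3 → ℝ) (hf : M.IsZonal f) (Ω : ℝ) :
    ∃ F W X : ℝ → ℝ,
      ContDiffOn ℝ ∞ F (Set.Ioo α₀ α₁) ∧ ContDiffOn ℝ ∞ W (Set.Ioo α₀ α₁) ∧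
      ContDiffOn ℝ ∞ X (Set.Ioo α₀ α₁) ∧
      (∀ x ∈ M.carrier, f x = F (ξ x) ∧ M.laplacian f x = W (ξ x) ∧ M.chi x = X (ξ x)) ∧
      ((∃ lam : ℂ, lam.re ≠ 0 ∧ M.IsLinearizedEigenvalue f Ω lam) →
        ((∃ s ∈ Set.Ioo α₀ α₁, deriv W s - Ω * deriv X s < 0) ∧
          (∃ s ∈ Set.Ioo α₀ α₁, 0 < deriv W s - Ω * deriv X s)) ∧
        ∀ K : ℝ, ∃ s ∈ Set.Ioo α₀ α₁,
          (deriv W s - Ω * deriv X s) * (deriv F s - K) < 0) := by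
  have hfs := hf.1.locallySmooth
  have hfinv := fun s x (hx : x ∈ M.carrier) => hf.rotation_eq hrot s hx
  obtain ⟨F, hFs, hF⟩ := hξ.exists_factorization hrot hα₀ hα₁ hfs hfinv
  obtain ⟨W, hWs, hW⟩ := hξ.exists_factorization hrot hα₀ hα₁ hfs.laplacian
    fun s x hx => hfs.laplacian_rotation hrot hfinv s hx
  obtain ⟨X, hXs, hX⟩ := hξ.exists_factorization hrot hα₀ hα₁ locallySmooth_chi
    fun s x hx => hrot.chi s hx
  refine ⟨F, W, X, hFs, hWs, hXs, fun x hx => ⟨hF x hx, hW x hx, hX x hx⟩, ?_⟩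
  rintro ⟨lam, hlam, ζ, hne, ⟨hζ, -⟩, -, η, hre, him, heq⟩
  have hμ : RotationPreserving M.area := measurePreserving_axisRotation hrot
  obtain ⟨k, hk⟩ := hμ.exists_mode_ne_zero hζ hne
  obtain ⟨hη, E, hE, hEint⟩ := exists_energy hrot hξ hζ hre him hk
  have hQs : ContDiffOn ℝ ∞ (fun s => W s - Ω * X s) (Ioo α₀ α₁) :=
    hWs.sub (contDiffOn_const.mul hXs)
  have hQ : ∀ s ∈ Ioo α₀ α₁,
      deriv (fun s => W s - Ω * X s) s = deriv W s - Ω * deriv X s := by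
    intro s hs
    have hI := isOpen_Ioo.mem_nhds hs
    have hWd := (hWs.contDiffAt hI).differentiableAt (by simp)
    have hXd := (hXs.contDiffAt hI).differentiableAt (by simp)
    rw [deriv_fun_sub hWd (hXd.const_mul Ω), deriv_const_mul Ω hXd]
  have hmode := ae_mode_equation hrot hξ hα₀ hα₁ hfs
    (hfs.laplacian.sub_const_mul locallySmooth_chi Ω) hFs hQs hF
    (fun x hx => by rw [hW x hx, hX x hx]) hζ hη heq k
  obtain ⟨h1, h2⟩ := sign_conditions (k := (k : ℝ)) (hμ.memLp_mode k hζ) (hμ.memLp_mode k hη) hlam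
    (by simpa using hmode) hE hEint
  have hIoo : ∀ᵐ x ∂M.area, ξ x ∈ Ioo α₀ α₁ := by
    filter_upwards [ae_mem_carrier, hξ.ae_axisDistSq_ne hrot] with x hx hx0
    exact hξ.mem_Ioo hrot hα₀ hα₁ hx hx0
  refine ⟨⟨?_, ?_⟩, fun K => ?_⟩
  · by_contra! hcon
    refine h1 1 one_ne_zero (hIoo.mono fun x hx => ?_)
    rw [hQ _ hx, one_mul]
    exact hcon _ hx
  · by_contra! hcon
    refine h1 (-1) (by norm_num) (hIoo.mono fun x hx => ?_)
    rw [hQ _ hx, neg_one_mul]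
    exact neg_nonneg.2 (hcon _ hx)
  · by_contra! hcon
    refine h2 K (hIoo.mono fun x hx => ?_)
    rw [hQ _ hx]
    exact hcon _ hx
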